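/- **Setting.** A power grid is a connected simple graph $\mathcal G=(\mathcal N,\mathcal L)$ with $n$ nodes (cities) and $m$ lines, an arbitrary orientation of the lines, and susceptances $\beta_\ell>0$. For a set $F$ of failed lines let $\mathbf C$ be the edge-vertex incidence matrix, $\mathbf B$ the diagonal matrix of susceptances (with $0$ for failed lines), $\mathbf L=\mathbf C^\top \mathbf B\mathbf C$, and $\mathbf V_F=\mathbf B\mathbf C\mathbf L^+$ the PTDF matrix of the remaining network ($\mathbf L^+$ is the Moore–Penrose inverse); $\mathbf V=\mathbf V_\emptyset$. Fix $\lambda\in(0,1)$. Given a demand vector $\mathbf d$: * the operational generation $\mathbf g^*(\mathbf d)$ minimizes $\sum_i g_i^2/2$ subject to $\sum_i g_i=\sum_i d_i$ and $|\mathbf V(\mathbf g-\mathbf d)|\le\lambda|\mathbf V\mathbf d|$ (componentwise); the emergency limit of line $j$ is $F_j(\mathbf d)=|(\mathbf V\mathbf d)_j|$; * the cascade starts with $\mathbf g=\mathbf g^*(\mathbf d)$, demand $\mathbf d$, and the failure of a line $\ell^{(1)}=\ell$. After every failure, in each connected component $A$ of the remaining network with imbalance $Y=\sum_{k\in A}(g_k-d_k)$,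 the current demands in $A$ are multiplied by $1-|Y|/\sum_{k\in A}d_k$ if $Y<0$, and the current generations in $A$ by $1-Y/\sum_{k\in A}g_k$ if $Y\ge 0$. After the failure of $\ell^{(1)},\dots,\ell^{(r-1)}$ ($r\ge2$) and this shedding, the flow is $f^{(r)}=\mathbf V_{\{\ell^{(1)},\dots,\ell^{(r-1)}\}}(\mathbf g-\mathbf d)$, so that $f^{(r)}_j=0$ on failed lines. The next line to fail is a maximizer of $|f^{(r)}_j|/F_j(\mathbf d)$ among the surviving lines with $|f_j^{(r)}|\ge F_j(\mathbf d)$ (any maximizer in case of ties); if there is no such line the cascade stops. **Assumption.** For every node $i$ and every first failure $\ell$, at every stage $r\ge2$ of the cascade with demand $\mathbf e_i$ (the $i$-th unit vector): the next line to fail, if there is one, is the unique maximizer, and $|f_j^{(r)}(\mathbf e_i)|\ne F_j(\mathbf e_i)$ for all lines $j$ (including failed ones, with flow $0$; in particular all $F_j(\mathbf e_i)$ are nonzero). Let $Z(i,\ell)$ be the number of nodes that are not in the same component as $i$ after the cascade with demand $\mathbf e_i$ and first failure $\ell$. Let the demands $X_1,\dots,X_n$ be i.i.d. Pareto, $\mathbb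 P(X_k>x)=(x/x_{\min})^{-\alpha}=Kx^{-\alpha}$ for $x\ge x_{\min}$, where $x_{\min},\alpha>0$ and $K=x_{\min}^{\alpha}$. Let the first failure be uniform on $\mathcal L$ and independent of the demands. Let $$S=\Bigl|\sum_{k\in A_1}\bigl(X_k-g^*_k(X)\bigr)\Bigr|,$$ where $A_1$ is the component that contains the city with the largest demand after the cascade with demand $X$. **Theorem.** Under the assumption, as $x\to\infty$: 1. if $Z(i,\ell)=0$ for all $i$ and $\ell$, then $\mathbb P(S>x)=O(x^{-2\alpha})$; 2. otherwise $\mathbb P(S>x)\sim C x^{-\alpha}$, where $$C=\sum_{i=1}^n\sum_{\ell=1}^m\frac Km\Bigl(\frac{Z(i,\ell)\,\lambda}{n}\Bigr)^{\alpha}\in(0,\infty).$$ -/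

import Mathlib

open MeasureTheory ProbabilityTheory Filter Asymptotics
open scoped Matrix

/-- `P` is the Moore-Penrose pseudo-inverse of the real matrix `A` (the four Penrose equations). -/
structure IsMoorePenrose {N : Type*} [Fintype N] (A P : Matrix N N ℝ) : Prop where
  mul_mul_self : A * P * A = A
  inv_mul_mul : P * A * P = P
  symm_left : (A * P)ᵀ = A * P
  symm_right : (P * A)ᵀ = P * A

/-- The Moore-Penrose pseudo-inverse is unique. -/
theorem IsMoorePenrose.unique {N : Type*} [Fintype N] {A P Q : Matrix N N ℝ}
    (hP : IsMoorePenrose A P) (hQ : IsMoorePenrose A Q) : P = Q := by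
  have h1 : A * P = A * Q := by
    calc A * P = (A * Q * A) * P := by rw [hQ.mul_mul_self]
      _ = (A * Q) * (A * P) := by simp only [Matrix.mul_assoc]
      _ = (A * Q)ᵀ * (A * P)ᵀ := by rw [hQ.symm_left, hP.symm_left]
      _ = ((A * P * A) * Q)ᵀ := by
        rw [← Matrix.transpose_mul]; simp only [Matrix.mul_assoc]
      _ = A * Q := by rw [hP.mul_mul_self, hQ.symm_left]
  have h2 : P * A = Q * A := by
    calc P * A = P * (A * Q * A) := by rw [hQ.mul_mul_self]
      _ = (P * A) * (Q * A) := by simp only [Matrix.mul_assoc]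
      _ = (P * A)ᵀ * (Q * A)ᵀ := by rw [hP.symm_right, hQ.symm_right]
      _ = (Q * (A * P * A))ᵀ := by
        rw [← Matrix.transpose_mul]; simp only [Matrix.mul_assoc]
      _ = Q * A := by rw [hP.mul_mul_self, hQ.symm_right]
  calc P = P * A * P := hP.inv_mul_mul.symm
    _ = Q * (A * P) := by rw [h2, Matrix.mul_assoc]
    _ = Q * A * Q := by rw [h1, Matrix.mul_assoc]
    _ = Q := hQ.inv_mul_mul

/-- Every real symmetric matrix has a Moore-Penrose pseudo-inverse. -/
theorem exists_isMoorePenrose {N : Type*} [Fintype N] [DecidableEq N] (A : Matrix N N ℝ)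
    (hA : A.IsHermitian) : ∃ P, IsMoorePenrose A P := by
  obtain ⟨U, D, hU, hAD⟩ : ∃ (U : Matrix N N ℝ) (D : N → ℝ), Uᵀ * U = 1 ∧
      A = U * Matrix.diagonal D * Uᵀ := by
    refine ⟨hA.eigenvectorUnitary, hA.eigenvalues, ?_, ?_⟩
    · have := Matrix.UnitaryGroup.star_mul_self hA.eigenvectorUnitary
      simpa [Matrix.star_eq_conjTranspose] using this
    · have := hA.spectral_theorem
      rw [Unitary.conjStarAlgAut_apply] at this
      simpa [Matrix.star_eq_conjTranspose, Function.comp_def] using this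
  have key : ∀ X Y : N → ℝ, (U * Matrix.diagonal X * Uᵀ) * (U * Matrix.diagonal Y * Uᵀ)
      = U * Matrix.diagonal (fun i => X i * Y i) * Uᵀ := by
    intro X Y
    calc _ = U * Matrix.diagonal X * (Uᵀ * U) * Matrix.diagonal Y * Uᵀ := by
          simp only [Matrix.mul_assoc]
      _ = _ := by
          rw [hU, Matrix.mul_one, Matrix.mul_assoc U, Matrix.diagonal_mul_diagonal]
  have symm : ∀ X : N → ℝ, (U * Matrix.diagonal X * Uᵀ)ᵀ = U * Matrix.diagonal X * Uᵀ := by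
    intro X
    simp [Matrix.transpose_mul, Matrix.mul_assoc]
  refine ⟨U * Matrix.diagonal (fun i => (D i)⁻¹) * Uᵀ, ?_, ?_, ?_, ?_⟩
  · have h : (fun i => D i * (D i)⁻¹ * D i) = D := funext fun i => mul_inv_mul_cancel (D i)
    rw [hAD, key, key, h]
  · have h : (fun i => (D i)⁻¹ * D i * (D i)⁻¹) = fun i => (D i)⁻¹ :=
      funext fun i => by simpa using mul_inv_mul_cancel (D i)⁻¹
    rw [hAD, key, key, h]
  · rw [hAD, key, symm]
  · rw [hAD, key, symm]

/-- The Moore-Penrose pseudo-inverse `A⁺` of a real symmetric matrix. -/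
noncomputable def pinv {N : Type*} [Fintype N] (A : Matrix N N ℝ) : Matrix N N ℝ :=
  Classical.epsilon (IsMoorePenrose A)

theorem pinv_spec {N : Type*} [Fintype N] [DecidableEq N] (A : Matrix N N ℝ)
    (hA : A.IsHermitian) : IsMoorePenrose A (pinv A) :=
  Classical.epsilon_spec (exists_isMoorePenrose A hA)

/-- A power grid with node set `N` and line set `E`: a connected simple graph, with an arbitrary
orientation `src e ⟶ tgt e` of every line and a positive susceptance on every line. -/
structure PowerGrid (N E : Type*) where
  src : E → N
  tgt : E → N
  src_ne_tgt : ∀ e, src e ≠ tgt e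
  no_parallel : Function.Injective fun e => s(src e, tgt e)
  susceptance : E → ℝ
  susceptance_pos : ∀ e, 0 < susceptance e
  connected : (SimpleGraph.fromEdgeSet (Set.range fun e => s(src e, tgt e))).Connected

namespace PowerGrid

/-- The graph on the nodes formed by the lines outside the set `F` of failed lines. -/
def remaining {N E : Type*} (G : PowerGrid N E) (F : Finset E) : SimpleGraph N :=
  SimpleGraph.fromEdgeSet ((fun e => s(G.src e, G.tgt e)) '' {e | e ∉ F})

open Classical in
/-- The island (connected component) of node `k` in the network without the lines in `F`. -/
noncomputable def island {N E : Type*} [Fintype N] (G : PowerGrid N E) (F : Finset E) (k : N) :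
    Finset N :=
  Finset.univ.filter fun l => (G.remaining F).Reachable k l

/-- The edge-vertex incidence matrix `C`. -/
def incidence {N E : Type*} [DecidableEq N] (G : PowerGrid N E) : Matrix E N ℝ :=
  Matrix.of fun e k => if k = G.src e then 1 else if k = G.tgt e then -1 else 0

/-- The diagonal matrix `B` of susceptances, where the failed lines get the entry `0`. -/
def suscMatrix {N E : Type*} [DecidableEq E] (G : PowerGrid N E) (F : Finset E) : Matrix E E ℝ :=
  Matrix.diagonal fun e => if e ∈ F then 0 else G.susceptance e

variable {N E : Type*} [Fintype N] [DecidableEq N] [Fintype E] [DecidableEq E]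

/-- The weighted Laplacian `L = Cᵀ B C` of the network without the lines in `F`. -/
def laplacian (G : PowerGrid N E) (F : Finset E) : Matrix N N ℝ :=
  G.incidenceᵀ * G.suscMatrix F * G.incidence

/-- The PTDF matrix `V = B C L⁺` of the network without the lines in `F`. Along the islands `L` is
block diagonal, hence so is `L⁺`, and the blocks of `V` are the PTDF matrices of the islands. The
rows of the failed lines are zero. -/
noncomputable def ptdf (G : PowerGrid N E) (F : Finset E) : Matrix E N ℝ :=
  G.suscMatrix F * G.incidence * pinv (G.laplacian F)

/-- Feasibility in the operational OPF with demand `d` and loading factor `lam`: total generation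
equals total demand, and `|V (g - d)| ≤ lam |V d|` on every line. -/
def IsFeasible (G : PowerGrid N E) (lam : ℝ) (d g : N → ℝ) : Prop :=
  ∑ k, g k = ∑ k, d k ∧ ∀ e, |(G.ptdf ∅ *ᵥ (g - d)) e| ≤ lam * |(G.ptdf ∅ *ᵥ d) e|

/-- `g` solves the operational OPF: it minimizes `∑ gₖ² / 2` among the feasible generations. -/
def IsDispatch (G : PowerGrid N E) (lam : ℝ) (d g : N → ℝ) : Prop :=
  G.IsFeasible lam d g ∧ ∀ g', G.IsFeasible lam d g' → ∑ k, g k ^ 2 / 2 ≤ ∑ k, g' k ^ 2 / 2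

/-- The emergency line limit `F_e = |(V d)_e|`, for the initial demand `d`. -/
noncomputable def limit (G : PowerGrid N E) (d : N → ℝ) (e : E) : ℝ :=
  |(G.ptdf ∅ *ᵥ d) e|

/-- The power imbalance (generation minus demand) in the island of node `k`. -/
noncomputable def imbalance (G : PowerGrid N E) (F : Finset E) (g d : N → ℝ) (k : N) : ℝ :=
  ∑ l ∈ G.island F k, (g l - d l)

open Classical in
/-- Uniform shedding of generation: in islands with nonnegative imbalance `Y`, generation is
scaled by `1 - Y / ∑ g`, which brings its total down to the total demand. -/
noncomputable def shedGen (G : PowerGrid N E) (F : Finset E) (g d : N → ℝ) (k : N) : ℝ :=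
  if G.imbalance F g d k < 0 then g k
  else (1 - G.imbalance F g d k / ∑ l ∈ G.island F k, g l) * g k

open Classical in
/-- Uniform shedding of demand: in islands with negative imbalance `Y`, demand is scaled by
`1 - |Y| / ∑ d`, which brings its total down to the total generation. -/
noncomputable def shedDem (G : PowerGrid N E) (F : Finset E) (g d : N → ℝ) (k : N) : ℝ :=
  if G.imbalance F g d k < 0 then (1 - |G.imbalance F g d k| / ∑ l ∈ G.island F k, d l) * d k
  else d k

/-- A stage of the cascade: the failed lines, and the current generation and demand. -/
structure Stage (N E : Type*) where
  failed : Finset E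
  gen : N → ℝ
  dem : N → ℝ

/-- Failure of the line `e`, followed by uniform shedding in every island. -/
noncomputable def fail (G : PowerGrid N E) (s : Stage N E) (e : E) : Stage N E where
  failed := insert e s.failed
  gen := G.shedGen (insert e s.failed) s.gen s.dem
  dem := G.shedDem (insert e s.failed) s.gen s.dem

/-- The line flows at a stage; failed lines carry no flow. -/
noncomputable def flow (G : PowerGrid N E) (s : Stage N E) : E → ℝ :=
  G.ptdf s.failed *ᵥ (s.gen - s.dem)

/-- The surviving lines at which the emergency limit (for the initial demand `d`) is reached. -/
def overloaded (G : PowerGrid N E) (d : N → ℝ) (s : Stage N E) : Set E :=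
  {e | e ∉ s.failed ∧ G.limit d e ≤ |G.flow s e|}

/-- `e` may fail next: it maximizes `|f_e| / F_e` among the overloaded lines. -/
def IsNextFailure (G : PowerGrid N E) (d : N → ℝ) (s : Stage N E) (e : E) : Prop :=
  e ∈ G.overloaded d s ∧
    ∀ e' ∈ G.overloaded d s, |G.flow s e'| / G.limit d e' ≤ |G.flow s e| / G.limit d e

/-- The stages, from the first failure on, of the cascades with demand `d`, loading factor `lam`
and first failure `e₀`. If several lines maximize the relative exceedance, any of them may fail
next. -/
inductive IsStage (G : PowerGrid N E) (lam : ℝ) (d : N → ℝ) (e₀ : E) : Stage N E → Prop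
  | first (g : N → ℝ) (hg : G.IsDispatch lam d g) : IsStage G lam d e₀ (G.fail ⟨∅, g, d⟩ e₀)
  | next (s : Stage N E) (e : E) (hs : IsStage G lam d e₀ s) (he : G.IsNextFailure d s e) :
      IsStage G lam d e₀ (G.fail s e)

/-- `F` is the set of failed lines when a cascade has stopped. -/
def IsFinalFailure (G : PowerGrid N E) (lam : ℝ) (d : N → ℝ) (e₀ : E) (F : Finset E) : Prop :=
  ∃ s, G.IsStage lam d e₀ s ∧ G.overloaded d s = ∅ ∧ s.failed = F

/-- The non-degeneracy assumption, for every position `i` of the sink and every first failure: in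
the cascade under the unit demand at `i`, the line that fails next is always unique, and from the
first failure on no line flow has exactly the size of the limit of its line. The latter concerns
all lines, with flow `0` on the failed ones, so that all limits are nonzero. -/
def NonDegenerate (G : PowerGrid N E) (lam : ℝ) : Prop :=
  ∀ (i : N) (e₀ : E) (s : Stage N E), G.IsStage lam (Pi.single i 1) e₀ s →
    (∀ e e', G.IsNextFailure (Pi.single i 1) s e → G.IsNextFailure (Pi.single i 1) s e' → e = e') ∧
    ∀ e, |G.flow s e| ≠ G.limit (Pi.single i 1) e

/-- `Z(i, e₀)`: the number of nodes that are not in the island of `i` after the cascade under the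
unit demand at `i` with first failure `e₀`. -/
noncomputable def numCutOff (G : PowerGrid N E) (lam : ℝ) (i : N) (e₀ : E) : ℕ :=
  Set.ncard {k | ∃ F, G.IsFinalFailure lam (Pi.single i 1) e₀ F ∧ k ∉ G.island F i}

/-- `S = s` is a possible size of the blackout for demand `x` and first failure `e₀`: it is
`|∑ (x k - g k)|`, where `g` is the operational generation, summed over the island of a
city with the largest demand after the cascade. -/
def IsBlackoutSize (G : PowerGrid N E) (lam : ℝ) (x : N → ℝ) (e₀ : E) (s : ℝ) : Prop :=
  ∃ (g : N → ℝ) (F : Finset E) (i : N), G.IsDispatch lam x g ∧ G.IsFinalFailure lam x e₀ F ∧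
    (∀ k, x k ≤ x i) ∧ s = |∑ k ∈ G.island F i, (x k - g k)|

end PowerGrid

open Topology

set_option linter.unusedSectionVars false

/-! ### Laplacian, pseudo-inverse and PTDF matrix of the intact grid. -/

namespace PowerGrid

variable {N E : Type*} [Fintype N] [DecidableEq N] [Fintype E] [DecidableEq E]

/-! A large blackout is caused by one huge demand. Divided by its maximum, the demand vector is then
close to a unit vector, and the model is homogeneous under positive scaling, so it suffices to
understand the cascade near unit vectors.

For a unit demand at `i` the dispatch is explicit. The phase angle is largest at the sink, so all
lines at `i` carry flow in the same direction, and conservation at `i` turns the line constraints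
into a lower bound on `g i` (`IsFeasible.le_apply_single`). The vector of least norm under this
bound is `mixedGen`. An island `A` of `i` therefore has imbalance of size `lam - lam * |A| / n = lam
* Z / n`.

Near a unit demand, the dispatch varies continuously, by compactness and without uniqueness at other
demands; shedding is continuous on the nonnegative cone; and non-degeneracy makes both the set of
overloaded lines and the next failure locally constant. Induction over the stages
(`NonDegenerate.tracks`, `NonDegenerate.exists_final`) shows that the final failed set is locally
constant. Hence `S` is `X i * (lam * Z / n)` up to a small multiple of `X i`, and exactly zero if `Z
= 0`, since total generation equals total demand.

The tail is then a single-big-jump argument, abstracted in `DominatedByMax`. By independence, two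
demands exceed `η * x` with probability of order `x ^ (-2α)`. Off this event, `{x < S}` lies between
unions over `(i, e)` of the events `ℓ = e`, `x < (a (i, e) ∓ δ) * X i`, whose probabilities are
explicit; then `δ` tends to zero. -/

theorem incidence_mulVec (G : PowerGrid N E) (θ : N → ℝ) (e : E) :
    (G.incidence *ᵥ θ) e = θ (G.src e) - θ (G.tgt e) := by
  have h : ∀ k, G.incidence e k * θ k =
      (if k = G.src e then θ k else 0) - (if k = G.tgt e then θ k else 0) := by
    intro k
    have := G.src_ne_tgt e
    simp only [incidence, Matrix.of_apply]
    split_ifs with h1 h2 <;> simp_all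
  simp [Matrix.mulVec, dotProduct, h, Finset.sum_sub_distrib]

theorem suscMatrix_mulVec (G : PowerGrid N E) (f : E → ℝ) (e : E) :
    (G.suscMatrix ∅ *ᵥ f) e = G.susceptance e * f e := by
  simp [suscMatrix, Matrix.mulVec_diagonal]

theorem laplacian_isHermitian (G : PowerGrid N E) (F : Finset E) :
    (G.laplacian F).IsHermitian := by
  simp [Matrix.IsHermitian, laplacian, Matrix.conjTranspose_eq_transpose_of_trivial,
    Matrix.transpose_mul, suscMatrix, Matrix.mul_assoc]

theorem laplacian_transpose (G : PowerGrid N E) (F : Finset E) :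
    (G.laplacian F)ᵀ = G.laplacian F := by
  simpa [Matrix.IsHermitian, Matrix.conjTranspose_eq_transpose_of_trivial]
    using G.laplacian_isHermitian F

theorem laplacian_mulVec (G : PowerGrid N E) (θ : N → ℝ) (k : N) :
    (G.laplacian ∅ *ᵥ θ) k =
      ∑ e, G.incidence e k * (G.susceptance e * (θ (G.src e) - θ (G.tgt e))) := by
  rw [laplacian, Matrix.mul_assoc, ← Matrix.mulVec_mulVec, ← Matrix.mulVec_mulVec]
  simp only [Matrix.mulVec, dotProduct, Matrix.transpose_apply]
  refine Finset.sum_congr rfl fun e _ => ?_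
  congr 1
  have h1 := G.suscMatrix_mulVec (G.incidence *ᵥ θ) e
  rw [G.incidence_mulVec] at h1
  exact h1

theorem laplacian_mulVec_one (G : PowerGrid N E) :
    G.laplacian ∅ *ᵥ (fun _ => (1 : ℝ)) = 0 := by
  ext k
  simp [laplacian_mulVec]

/-- On a connected grid, the kernel of the Laplacian consists of the constant vectors. -/
theorem const_of_laplacian_mulVec_eq_zero (G : PowerGrid N E) {w : N → ℝ}
    (hw : G.laplacian ∅ *ᵥ w = 0) (j k : N) : w j = w k := by
  -- The energy identity: this sum is the quadratic form of the Laplacian at `w`.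
  have h0 : ∑ e, G.susceptance e * (w (G.src e) - w (G.tgt e)) ^ 2 = 0 := by
    have h1 : w ⬝ᵥ (G.laplacian ∅ *ᵥ w) = 0 := by simp [hw]
    rw [← h1]
    simp only [dotProduct, laplacian_mulVec, Finset.mul_sum]
    rw [Finset.sum_comm]
    refine Finset.sum_congr rfl fun e _ => ?_
    have h2 := G.incidence_mulVec w e
    simp only [Matrix.mulVec, dotProduct] at h2
    calc _ = (w (G.src e) - w (G.tgt e)) * (G.susceptance e * (w (G.src e) - w (G.tgt e))) := by
          ring
      _ = (∑ i, G.incidence e i * w i) * (G.susceptance e * (w (G.src e) - w (G.tgt e))) := by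
          rw [h2]
      _ = _ := by
          rw [Finset.sum_mul]
          exact Finset.sum_congr rfl fun i _ => by ring
  have he : ∀ e, w (G.src e) = w (G.tgt e) := by
    intro e
    have h1 := (Finset.sum_eq_zero_iff_of_nonneg (fun e _ =>
      mul_nonneg (G.susceptance_pos e).le (sq_nonneg _))).1 h0 e (Finset.mem_univ e)
    have h2 := (mul_eq_zero.1 h1).resolve_left (G.susceptance_pos e).ne'
    exact sub_eq_zero.1 (by simpa using h2)
  obtain ⟨p⟩ := G.connected.preconnected j k
  induction p with
  | nil => rfl
  | cons h _ ih =>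
    rw [← ih]
    rw [SimpleGraph.fromEdgeSet_adj] at h
    obtain ⟨⟨e, hee⟩, -⟩ := h
    rcases Sym2.eq_iff.1 hee with ⟨h1, h2⟩ | ⟨h1, h2⟩
    · rw [← h1, ← h2, he]
    · rw [← h1, ← h2, he]

/-- The residual `v - L L⁺ v` is killed by `L`, hence constant, and its entries sum to zero because
the columns of `L` do. So it vanishes. -/
theorem laplacian_mulVec_pinv_mulVec (G : PowerGrid N E) {v : N → ℝ} (hv : ∑ k, v k = 0) :
    G.laplacian ∅ *ᵥ (pinv (G.laplacian ∅) *ᵥ v) = v := by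
  set L := G.laplacian ∅ with hL
  have hP := pinv_spec L (G.laplacian_isHermitian ∅)
  have hLT : Lᵀ = L := G.laplacian_transpose ∅
  have h1 : L * (L * pinv L) = L := by
    have h2 := congrArg Matrix.transpose hP.mul_mul_self
    rwa [Matrix.transpose_mul, hP.symm_left, hLT] at h2
  have h2 : L *ᵥ (v - L *ᵥ (pinv L *ᵥ v)) = 0 := by
    rw [Matrix.mulVec_sub, Matrix.mulVec_mulVec, Matrix.mulVec_mulVec, Matrix.mul_assoc, h1, sub_self]
  have h3 := G.const_of_laplacian_mulVec_eq_zero h2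
  have h4 : ∑ k, (v - L *ᵥ (pinv L *ᵥ v)) k = 0 := by
    simp only [Pi.sub_apply, Finset.sum_sub_distrib, hv, zero_sub, neg_eq_zero]
    have h5 : (fun _ => (1 : ℝ)) ⬝ᵥ (L *ᵥ (pinv L *ᵥ v)) = 0 := by
      rw [Matrix.dotProduct_mulVec, ← Matrix.mulVec_transpose, hLT, hL, G.laplacian_mulVec_one]
      simp
    simpa [dotProduct] using h5
  symm
  ext k
  have h6 : (v - L *ᵥ (pinv L *ᵥ v)) k = 0 := by
    have h7 : ∑ j, (v - L *ᵥ (pinv L *ᵥ v)) j = Fintype.card N * (v - L *ᵥ (pinv L *ᵥ v)) k := by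
      rw [Finset.sum_congr rfl fun j _ => h3 j k, Finset.sum_const, Finset.card_univ, nsmul_eq_mul]
    rw [h4] at h7
    have : (Fintype.card N : ℝ) ≠ 0 := by
      have : Nonempty N := ⟨k⟩
      exact_mod_cast Fintype.card_ne_zero
    simpa [this] using h7.symm
  simpa [sub_eq_zero] using h6

theorem pinv_laplacian_mulVec_one (G : PowerGrid N E) :
    pinv (G.laplacian ∅) *ᵥ (fun _ => (1 : ℝ)) = 0 := by
  set L := G.laplacian ∅ with hL
  have hP := pinv_spec L (G.laplacian_isHermitian ∅)
  have hLT : Lᵀ = L := G.laplacian_transpose ∅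
  -- Symmetry of `L L⁺` moves a factor `L` to the right end of `L⁺`, where it kills constants.
  have h1 : pinv L * (pinv L)ᵀ * L = pinv L := by
    rw [← hLT, Matrix.mul_assoc, ← Matrix.transpose_mul, hLT, hP.symm_left, ← Matrix.mul_assoc,
      hP.inv_mul_mul]
  rw [← h1, ← Matrix.mulVec_mulVec, G.laplacian_mulVec_one, Matrix.mulVec_zero]

theorem ptdf_mulVec (G : PowerGrid N E) (v : N → ℝ) (e : E) :
    (G.ptdf ∅ *ᵥ v) e = G.susceptance e *
      ((pinv (G.laplacian ∅) *ᵥ v) (G.src e) - (pinv (G.laplacian ∅) *ᵥ v) (G.tgt e)) := by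
  rw [ptdf, ← Matrix.mulVec_mulVec, ← Matrix.mulVec_mulVec, suscMatrix_mulVec, incidence_mulVec]

theorem ptdf_mulVec_one (G : PowerGrid N E) : G.ptdf ∅ *ᵥ (fun _ => (1 : ℝ)) = 0 := by
  ext e
  simp [ptdf_mulVec, pinv_laplacian_mulVec_one]

theorem ptdf_mulVec_const (G : PowerGrid N E) (c : ℝ) : G.ptdf ∅ *ᵥ (fun _ => c) = 0 := by
  have : (fun _ : N => c) = c • fun _ => (1 : ℝ) := by ext; simp
  rw [this, Matrix.mulVec_smul, ptdf_mulVec_one, smul_zero]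

/-- Flow conservation: the net outflow at every node is the injection. -/
theorem sum_incidence_mul_ptdf (G : PowerGrid N E) {v : N → ℝ} (hv : ∑ k, v k = 0) (k : N) :
    ∑ e, G.incidence e k * (G.ptdf ∅ *ᵥ v) e = v k := by
  have h := congrFun (G.laplacian_mulVec_pinv_mulVec hv) k
  rw [laplacian_mulVec] at h
  simpa only [ptdf_mulVec] using h

theorem ptdf_mulVec_sub_const (G : PowerGrid N E) (v : N → ℝ) (c : ℝ) :
    G.ptdf ∅ *ᵥ (fun k => v k - c) = G.ptdf ∅ *ᵥ v := by
  have : (fun k => v k - c) = v - fun _ => c := rfl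
  rw [this, Matrix.mulVec_sub, ptdf_mulVec_const, sub_zero]

/-- With a single demand, the phase angle is largest at the sink. -/
theorem pinv_laplacian_single_le (G : PowerGrid N E) (i j : N) :
    (pinv (G.laplacian ∅) *ᵥ (Pi.single i 1 : N → ℝ)) j ≤
      (pinv (G.laplacian ∅) *ᵥ (Pi.single i 1 : N → ℝ)) i := by
  have : Nonempty N := ⟨i⟩
  have hn : (0 : ℝ) < Fintype.card N := by exact_mod_cast Fintype.card_pos
  set θ := pinv (G.laplacian ∅) *ᵥ (Pi.single i 1 : N → ℝ) with hθ
  -- Discrete maximum principle: at a node of maximal angle the net outflow is nonnegative, whereas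
  -- at every node other than `i` it equals `-1/n`.
  obtain ⟨k, hk⟩ := Finite.exists_max θ
  by_cases hki : k = i
  · subst hki; exact hk j
  exfalso
  have hv : ∑ k, ((Pi.single i 1 : N → ℝ) k - (Fintype.card N : ℝ)⁻¹) = 0 := by
    simp [Finset.sum_sub_distrib, hn.ne']
  have h := G.laplacian_mulVec_pinv_mulVec hv
  have h2 : pinv (G.laplacian ∅) *ᵥ
      (fun k => (Pi.single i 1 : N → ℝ) k - (Fintype.card N : ℝ)⁻¹) = θ := by
    have h3 : (fun k => (Pi.single i 1 : N → ℝ) k - (Fintype.card N : ℝ)⁻¹) =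
        Pi.single i 1 - (Fintype.card N : ℝ)⁻¹ • fun _ => (1 : ℝ) := by ext; simp
    rw [h3, Matrix.mulVec_sub, Matrix.mulVec_smul, pinv_laplacian_mulVec_one, smul_zero, sub_zero]
  rw [h2] at h
  have h4 := congrFun h k
  rw [laplacian_mulVec] at h4
  have h5 : 0 ≤ ∑ e, G.incidence e k * (G.susceptance e * (θ (G.src e) - θ (G.tgt e))) := by
    refine Finset.sum_nonneg fun e _ => ?_
    have hb := G.susceptance_pos e
    simp only [incidence, Matrix.of_apply]
    split_ifs with h6 h7
    · rw [one_mul, ← h6]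
      exact mul_nonneg hb.le (sub_nonneg.2 (hk _))
    · rw [← h7]
      nlinarith [mul_nonneg hb.le (sub_nonneg.2 (hk (G.src e)))]
    · simp
  rw [h4, Pi.single_eq_of_ne hki] at h5
  have := inv_pos.2 hn
  linarith

/-- Since the angle is maximal at `i`, the outflow from `i` along each incident line is nonnegative,
so no cancellation occurs between lines at the sink. -/
theorem abs_ptdf_single_le (G : PowerGrid N E) (i : N) (e : E) :
    |G.incidence e i| * |(G.ptdf ∅ *ᵥ (Pi.single i 1 : N → ℝ)) e| ≤
      G.incidence e i * (G.ptdf ∅ *ᵥ (Pi.single i 1 : N → ℝ)) e := by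
  have hb := G.susceptance_pos e
  rw [← abs_mul]
  refine (abs_of_nonneg ?_).le
  rw [ptdf_mulVec]
  simp only [incidence, Matrix.of_apply]
  split_ifs with h6 h7
  · rw [one_mul, ← h6]
    exact mul_nonneg hb.le (sub_nonneg.2 (G.pinv_laplacian_single_le _ _))
  · rw [← h7]
    nlinarith [mul_nonneg hb.le (sub_nonneg.2 (G.pinv_laplacian_single_le i (G.src e)))]
  · simp

/-! ### The operational dispatch near a unit demand. -/

/-- The generation `(1 - lam) d + lam d̄`, where `d̄` is the average of `d`. -/
noncomputable def mixedGen (lam : ℝ) (d : N → ℝ) (k : N) : ℝ :=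
  (1 - lam) * d k + lam * ((∑ l, d l) / Fintype.card N)

/-- The deviation from `d` is `-lam • d` plus a constant vector, and the PTDF matrix kills
constants: every line constraint holds with equality. -/
theorem isFeasible_mixedGen [Nonempty N] (G : PowerGrid N E) {lam : ℝ} (h0 : 0 ≤ lam)
    (d : N → ℝ) : G.IsFeasible lam d (mixedGen lam d) := by
  have hn : (Fintype.card N : ℝ) ≠ 0 := by exact_mod_cast Fintype.card_ne_zero
  refine ⟨?_, fun e => ?_⟩
  · simp only [mixedGen, Finset.sum_add_distrib, ← Finset.mul_sum, Finset.sum_const,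
      Finset.card_univ, nsmul_eq_mul]
    field_simp
    ring
  · have h : mixedGen lam d - d =
        (-lam) • d + fun _ => lam * ((∑ l, d l) / Fintype.card N) := by
      ext k; simp [mixedGen]; ring
    rw [h, Matrix.mulVec_add, ptdf_mulVec_const, add_zero, Matrix.mulVec_smul]
    simp [abs_mul, abs_of_nonneg h0]

theorem IsDispatch.sum_sq_le [Nonempty N] {G : PowerGrid N E} {lam : ℝ} (h0 : 0 ≤ lam)
    {d g : N → ℝ} (h : G.IsDispatch lam d g) : ∑ k, g k ^ 2 ≤ ∑ k, mixedGen lam d k ^ 2 := by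
  have := h.2 _ (G.isFeasible_mixedGen h0 d)
  rw [← Finset.sum_div, ← Finset.sum_div] at this
  linarith

theorem mixedGen_single (lam : ℝ) (i k : N) :
    mixedGen lam (Pi.single i 1) k = (1 - lam) * (Pi.single i 1 : N → ℝ) k +
      lam / Fintype.card N := by
  simp [mixedGen, div_eq_mul_inv]

/-- By conservation at `i`, `g i - 1` is a signed sum of flows on the lines at `i`. Each is at most
`lam` times the flow of the unit demand, and those flows add up to `1 - 1/n` without cancellation.
-/
theorem IsFeasible.le_apply_single {G : PowerGrid N E} {lam : ℝ} {i : N}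
    {g : N → ℝ} (h : G.IsFeasible lam (Pi.single i 1) g) :
    1 - lam + lam / Fintype.card N ≤ g i := by
  have : Nonempty N := ⟨i⟩
  have hn : (Fintype.card N : ℝ) ≠ 0 := by exact_mod_cast Fintype.card_ne_zero
  have h1 : ∑ k, (g - Pi.single i 1 : N → ℝ) k = 0 := by
    simp only [Pi.sub_apply, Finset.sum_sub_distrib, h.1, sub_self]
  have h2 := G.sum_incidence_mul_ptdf h1 i
  have hv : ∑ k, ((Pi.single i 1 : N → ℝ) k - (Fintype.card N : ℝ)⁻¹) = 0 := by
    simp [Finset.sum_sub_distrib, hn]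
  have h3 := G.sum_incidence_mul_ptdf hv i
  rw [ptdf_mulVec_sub_const] at h3
  have h4 : -(lam * ∑ e, G.incidence e i * (G.ptdf ∅ *ᵥ (Pi.single i 1 : N → ℝ)) e) ≤
      ∑ e, G.incidence e i * (G.ptdf ∅ *ᵥ (g - Pi.single i 1)) e := by
    rw [Finset.mul_sum, ← Finset.sum_neg_distrib]
    refine Finset.sum_le_sum fun e _ => ?_
    have h5 := h.2 e
    have h6 := G.abs_ptdf_single_le i e
    have h7 := neg_abs_le (G.incidence e i * (G.ptdf ∅ *ᵥ (g - Pi.single i 1)) e)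
    rw [abs_mul] at h7
    have h8 := mul_le_mul_of_nonneg_left h5 (abs_nonneg (G.incidence e i))
    have h9 : |G.incidence e i * (G.ptdf ∅ *ᵥ (Pi.single i 1 : N → ℝ)) e| =
      G.incidence e i * (G.ptdf ∅ *ᵥ (Pi.single i 1 : N → ℝ)) e :=
        le_antisymm (by rwa [abs_mul]) (le_abs_self _)
    rw [abs_mul] at h9
    rw [← h9]
    linarith
  rw [h2, h3] at h4
  simp only [Pi.sub_apply, Pi.single_eq_same] at h4
  rw [div_eq_mul_inv]
  linarith

/-- Convexity: with `m` the mixed generation, the bound on `g i` says that `g - m` has nonnegative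
inner product with `m`. Then `‖g‖² ≥ ‖m‖² + ‖g - m‖²`, so `‖g‖ ≤ ‖m‖` forces equality. -/
theorem IsFeasible.eq_mixedGen_single {G : PowerGrid N E} {lam : ℝ} (h1 : lam ≤ 1) {i : N}
    {g : N → ℝ} (h : G.IsFeasible lam (Pi.single i 1) g)
    (hle : ∑ k, g k ^ 2 ≤ ∑ k, mixedGen lam (Pi.single i 1) k ^ 2) :
    g = mixedGen lam (Pi.single i 1) := by
  have hN : Nonempty N := ⟨i⟩
  have hn : (Fintype.card N : ℝ) ≠ 0 := by exact_mod_cast Fintype.card_ne_zero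
  set m := mixedGen lam (Pi.single i 1 : N → ℝ) with hm
  have hi := h.le_apply_single
  have hs : ∑ k, g k = 1 := by simpa using h.1
  have key : ∑ k, m k * (g k - m k) = (1 - lam) * (g i - (1 - lam + lam / Fintype.card N)) := by
    have h2 : ∀ k, m k * (g k - m k) =
        (1 - lam) * ((Pi.single i 1 : N → ℝ) k * (g k - m k)) +
          lam / Fintype.card N * (g k - m k) := by
      intro k; rw [hm, mixedGen_single]; ring
    have h3 : ∑ k, (g k - m k) = 0 := by
      simp only [hm, mixedGen_single, Finset.sum_sub_distrib, Finset.sum_add_distrib, hs,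
        ← Finset.mul_sum]
      simp
      field_simp
      ring
    rw [Finset.sum_congr rfl fun k _ => h2 k, Finset.sum_add_distrib, ← Finset.mul_sum,
      ← Finset.mul_sum, h3, mul_zero, add_zero]
    simp [Pi.single_apply, hm, mixedGen_single]
  have key2 : ∑ k, g k ^ 2 = ∑ k, m k ^ 2 + ∑ k, (g k - m k) ^ 2 +
      2 * ∑ k, m k * (g k - m k) := by
    rw [Finset.mul_sum, ← Finset.sum_add_distrib, ← Finset.sum_add_distrib]
    exact Finset.sum_congr rfl fun k _ => by ring
  have h4 : 0 ≤ (1 - lam) * (g i - (1 - lam + lam / Fintype.card N)) :=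
    mul_nonneg (by linarith) (by linarith)
  have h5 : ∑ k, (g k - m k) ^ 2 = 0 :=
    le_antisymm (by linarith) (Finset.sum_nonneg fun _ _ => sq_nonneg _)
  ext k
  have h6 := (Finset.sum_eq_zero_iff_of_nonneg fun _ _ => sq_nonneg _).1 h5 k (Finset.mem_univ k)
  exact sub_eq_zero.1 (by simpa using h6)

/-- With a single sink, the operational generation is the mixture of the demand and its average. -/
theorem isDispatch_single_iff (G : PowerGrid N E) {lam : ℝ} (h0 : 0 ≤ lam) (h1 : lam ≤ 1) {i : N}
    {g : N → ℝ} :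
    G.IsDispatch lam (Pi.single i 1) g ↔ g = mixedGen lam (Pi.single i 1) := by
  have hN : Nonempty N := ⟨i⟩
  refine ⟨fun h => h.1.eq_mixedGen_single h1 (h.sum_sq_le h0), ?_⟩
  rintro rfl
  refine ⟨G.isFeasible_mixedGen h0 _, fun g' hg' => ?_⟩
  rw [← Finset.sum_div, ← Finset.sum_div]
  rcases le_total (∑ k, g' k ^ 2) (∑ k, mixedGen lam (Pi.single i 1) k ^ 2) with h | h
  · rw [hg'.eq_mixedGen_single h1 h]
  · linarith

theorem continuous_mixedGen (lam : ℝ) : Continuous (mixedGen lam : (N → ℝ) → N → ℝ) := by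
  unfold mixedGen
  fun_prop

/-- The operational generation depends continuously on the demand at a single sink. -/
theorem eventually_isDispatch_mem (G : PowerGrid N E) {lam : ℝ} (h0 : 0 ≤ lam) (h1 : lam ≤ 1)
    (i : N) {U : Set (N → ℝ)} (hU : U ∈ 𝓝 (mixedGen lam (Pi.single i 1))) :
    ∀ᶠ d in 𝓝 (Pi.single i 1 : N → ℝ), ∀ g, G.IsDispatch lam d g → g ∈ U := by
  have hN : Nonempty N := ⟨i⟩
  -- A closed relation containing all dispatches: optimality is weakened to beating `mixedGen`,
  -- which still determines `g` over the unit demand.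
  set R : Set ((N → ℝ) × (N → ℝ)) :=
    {p | G.IsFeasible lam p.1 p.2 ∧ ∑ k, p.2 k ^ 2 ≤ ∑ k, mixedGen lam p.1 k ^ 2} with hR
  have hcont := continuous_mixedGen (N := N) lam
  have hcontk : ∀ k, Continuous fun d : N → ℝ => mixedGen lam d k := fun k => by
    exact (continuous_apply k).comp hcont
  have hRc : IsClosed R := by
    have h2 : IsClosed {p : (N → ℝ) × (N → ℝ) | ∑ k, p.2 k = ∑ k, p.1 k} :=
      isClosed_eq (by fun_prop) (by fun_prop)
    have h3 : ∀ e, IsClosed {p : (N → ℝ) × (N → ℝ) |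
        |(G.ptdf ∅ *ᵥ (p.2 - p.1)) e| ≤ lam * |(G.ptdf ∅ *ᵥ p.1) e|} := fun e =>
      isClosed_le (by simp only [Matrix.mulVec, dotProduct, Pi.sub_apply]; fun_prop)
        (by simp only [Matrix.mulVec, dotProduct]; fun_prop)
    have h4 : IsClosed {p : (N → ℝ) × (N → ℝ) |
        ∑ k, p.2 k ^ 2 ≤ ∑ k, mixedGen lam p.1 k ^ 2} :=
      isClosed_le (by fun_prop) (continuous_finsetSum _ fun k _ =>
        ((hcontk k).comp continuous_fst).pow 2)
    have : R = ({p | ∑ k, p.2 k = ∑ k, p.1 k} ∩ ⋂ e, {p : (N → ℝ) × (N → ℝ) |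
        |(G.ptdf ∅ *ᵥ (p.2 - p.1)) e| ≤ lam * |(G.ptdf ∅ *ᵥ p.1) e|}) ∩
        {p | ∑ k, p.2 k ^ 2 ≤ ∑ k, mixedGen lam p.1 k ^ 2} := by
      ext p; simp [hR, IsFeasible]
    rw [this]
    exact (h2.inter (isClosed_iInter h3)).inter h4
  -- The slack `1` makes the norm bound strict at the unit demand, so it persists nearby and
  -- confines dispatches to a fixed compact ball, where the tube lemma applies.
  set M : ℝ := ∑ k, mixedGen lam (Pi.single i 1 : N → ℝ) k ^ 2 + 1 with hM
  have hM0 : 0 ≤ M := by positivity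
  have hK : IsCompact (Metric.closedBall (0 : N → ℝ) (Real.sqrt M)) := isCompact_closedBall _ _
  have hev := hK.eventually_forall_of_forall_eventually
    (x₀ := (Pi.single i 1 : N → ℝ)) (P := fun d g => (d, g) ∈ R → g ∈ U) (by
      intro y _
      by_cases hy : (Pi.single i 1, y) ∈ R
      · have : y = mixedGen lam (Pi.single i 1) := hy.1.eq_mixedGen_single h1 hy.2
        rw [this]
        filter_upwards [continuous_snd.continuousAt.preimage_mem_nhds hU] with z hz _ using hz
      · filter_upwards [hRc.isOpen_compl.mem_nhds hy] with z hz hz' using absurd hz' hz)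
  have hbd : ∀ᶠ d in 𝓝 (Pi.single i 1 : N → ℝ), ∑ k, mixedGen lam d k ^ 2 < M := by
    have : Continuous fun d : N → ℝ => ∑ k, mixedGen lam d k ^ 2 :=
      continuous_finsetSum _ fun k _ => (hcontk k).pow 2
    exact this.continuousAt.eventually_lt continuousAt_const (by rw [hM]; linarith)
  filter_upwards [hev, hbd] with d hd hdM g hg
  have hle := hg.sum_sq_le h0
  refine hd g ?_ ⟨hg.1, hle⟩
  rw [mem_closedBall_zero_iff, pi_norm_le_iff_of_nonneg (Real.sqrt_nonneg _)]
  intro k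
  rw [Real.norm_eq_abs]
  refine Real.abs_le_sqrt ?_
  have := Finset.single_le_sum (f := fun k => g k ^ 2) (fun _ _ => sq_nonneg _) (Finset.mem_univ k)
  linarith

end PowerGrid

/-! ### Continuity of load and generation shedding. -/

/-- The quotient may behave badly when `a₀ = 0`, but then `x` tends to zero while the factor stays
in `[0, 1]`. -/
theorem tendsto_min_one_div_mul {ι : Type*} {l : Filter ι} {x a b : ι → ℝ} {x₀ a₀ b₀ : ℝ}
    (hx : Tendsto x l (𝓝 x₀)) (ha : Tendsto a l (𝓝 a₀)) (hb : Tendsto b l (𝓝 b₀))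
    (ha0 : ∀ᶠ p in l, 0 ≤ a p) (hb0 : ∀ᶠ p in l, 0 ≤ b p) (h : a₀ = 0 → x₀ = 0) :
    Tendsto (fun p => min 1 (b p / a p) * x p) l (𝓝 (min 1 (b₀ / a₀) * x₀)) := by
  by_cases h0 : a₀ = 0
  · rw [h h0, mul_zero]
    rw [h h0] at hx
    refine squeeze_zero_norm' ?_ (by simpa using hx.norm)
    filter_upwards [ha0, hb0] with p h1 h2
    rw [norm_mul, Real.norm_eq_abs, abs_of_nonneg (le_min zero_le_one (div_nonneg h2 h1))]
    exact mul_le_of_le_one_left (norm_nonneg _) (min_le_left _ _)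
  · exact (tendsto_const_nhds.min (hb.div ha h0)).mul hx

namespace PowerGrid

variable {N E : Type*} [Fintype N] [DecidableEq N] [Fintype E] [DecidableEq E]

theorem mem_island_self (G : PowerGrid N E) (F : Finset E) (k : N) : k ∈ G.island F k := by
  simp [island]

theorem imbalance_eq (G : PowerGrid N E) (F : Finset E) (g d : N → ℝ) (k : N) :
    G.imbalance F g d k = ∑ l ∈ G.island F k, g l - ∑ l ∈ G.island F k, d l := by
  simp [imbalance]

/-- For nonnegative data both cases of the definition merge into one truncated ratio. If the island
generates nothing, `g k = 0` and the value of the quotient is irrelevant. -/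
theorem shedGen_eq (G : PowerGrid N E) (F : Finset E) {g d : N → ℝ} (hg : 0 ≤ g) (hd : 0 ≤ d)
    (k : N) : G.shedGen F g d k =
      min 1 ((∑ l ∈ G.island F k, d l) / ∑ l ∈ G.island F k, g l) * g k := by
  have h1 : g k ≤ ∑ l ∈ G.island F k, g l :=
    Finset.single_le_sum (fun l _ => hg l) (G.mem_island_self F k)
  have h2 : 0 ≤ g k := hg k
  have h3 : 0 ≤ ∑ l ∈ G.island F k, d l := Finset.sum_nonneg fun l _ => hd l
  rw [shedGen, imbalance_eq]
  set a := ∑ l ∈ G.island F k, g l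
  set b := ∑ l ∈ G.island F k, d l
  rcases (h2.trans h1).eq_or_lt with h0 | h0
  · have : g k = 0 := by linarith
    simp [this]
  · split_ifs with h
    · rw [min_eq_left (by rw [le_div_iff₀ h0]; linarith), one_mul]
    · rw [min_eq_right (by rw [div_le_iff₀ h0]; linarith), sub_div, div_self h0.ne']
      ring

theorem shedDem_eq (G : PowerGrid N E) (F : Finset E) {g d : N → ℝ} (hd : 0 ≤ d)
    (k : N) : G.shedDem F g d k =
      min 1 ((∑ l ∈ G.island F k, g l) / ∑ l ∈ G.island F k, d l) * d k := by
  have h1 : d k ≤ ∑ l ∈ G.island F k, d l :=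
    Finset.single_le_sum (fun l _ => hd l) (G.mem_island_self F k)
  have h2 : 0 ≤ d k := hd k
  rw [shedDem, imbalance_eq]
  set a := ∑ l ∈ G.island F k, g l
  set b := ∑ l ∈ G.island F k, d l
  rcases (h2.trans h1).eq_or_lt with h0 | h0
  · have : d k = 0 := by linarith
    simp [this]
  · split_ifs with h
    · rw [min_eq_right (by rw [div_le_iff₀ h0]; linarith), abs_of_neg h, neg_sub, sub_div,
        div_self h0.ne']
      ring
    · rw [min_eq_left (by rw [le_div_iff₀ h0]; linarith), one_mul]

/-- Shedding after the failure of the lines in `F`, as a map on pairs (generation, demand). -/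
noncomputable def shed (G : PowerGrid N E) (F : Finset E) (p : (N → ℝ) × (N → ℝ)) :
    (N → ℝ) × (N → ℝ) :=
  (G.shedGen F p.1 p.2, G.shedDem F p.1 p.2)

theorem shed_nonneg (G : PowerGrid N E) (F : Finset E) {p : (N → ℝ) × (N → ℝ)} (hp : 0 ≤ p) :
    0 ≤ G.shed F p := by
  refine ⟨fun k => ?_, fun k => ?_⟩
  · change 0 ≤ G.shedGen F p.1 p.2 k
    rw [G.shedGen_eq F hp.1 hp.2]
    exact mul_nonneg (le_min zero_le_one (div_nonneg (Finset.sum_nonneg fun l _ => hp.2 l)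
      (Finset.sum_nonneg fun l _ => hp.1 l))) (hp.1 k)
  · change 0 ≤ G.shedDem F p.1 p.2 k
    rw [G.shedDem_eq F hp.2]
    exact mul_nonneg (le_min zero_le_one (div_nonneg (Finset.sum_nonneg fun l _ => hp.1 l)
      (Finset.sum_nonneg fun l _ => hp.2 l))) (hp.2 k)

/-- Shedding is continuous at nonnegative generations and demands. -/
theorem tendsto_shed (G : PowerGrid N E) (F : Finset E) {p : (N → ℝ) × (N → ℝ)} (hp : 0 ≤ p) :
    Tendsto (G.shed F) (𝓝[Set.Ici 0] p) (𝓝[Set.Ici 0] (G.shed F p)) := by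
  refine tendsto_nhdsWithin_iff.2 ⟨?_, ?_⟩
  swap
  · filter_upwards [self_mem_nhdsWithin] with q hq using G.shed_nonneg F hq
  have h1 : ∀ k, Tendsto (fun q : (N → ℝ) × (N → ℝ) => q.1 k) (𝓝[Set.Ici 0] p) (𝓝 (p.1 k)) :=
    fun k => (Continuous.tendsto (by fun_prop) p).mono_left nhdsWithin_le_nhds
  have h2 : ∀ k, Tendsto (fun q : (N → ℝ) × (N → ℝ) => q.2 k) (𝓝[Set.Ici 0] p) (𝓝 (p.2 k)) :=
    fun k => (Continuous.tendsto (by fun_prop) p).mono_left nhdsWithin_le_nhds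
  have e1 : ∀ A : Finset N, ∀ᶠ q in 𝓝[Set.Ici 0] p, 0 ≤ ∑ l ∈ A, (q : (N → ℝ) × (N → ℝ)).1 l := by
    intro A
    filter_upwards [self_mem_nhdsWithin] with q hq using Finset.sum_nonneg fun l _ => hq.1 l
  have e2 : ∀ A : Finset N, ∀ᶠ q in 𝓝[Set.Ici 0] p, 0 ≤ ∑ l ∈ A, (q : (N → ℝ) × (N → ℝ)).2 l := by
    intro A
    filter_upwards [self_mem_nhdsWithin] with q hq using Finset.sum_nonneg fun l _ => hq.2 l
  refine Tendsto.prodMk_nhds (tendsto_pi_nhds.2 fun k => ?_) (tendsto_pi_nhds.2 fun k => ?_)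
  · rw [G.shedGen_eq F hp.1 hp.2]
    refine Tendsto.congr' ?_ (tendsto_min_one_div_mul (h1 k)
      (tendsto_finsetSum (G.island F k) fun l _ => h1 l)
      (tendsto_finsetSum (G.island F k) fun l _ => h2 l) (e1 _) (e2 _) fun h =>
        (Finset.sum_eq_zero_iff_of_nonneg fun l _ => hp.1 l).1 h k (G.mem_island_self F k))
    filter_upwards [self_mem_nhdsWithin] with q hq
    rw [G.shedGen_eq F hq.1 hq.2]
  · rw [G.shedDem_eq F hp.2]
    refine Tendsto.congr' ?_ (tendsto_min_one_div_mul (h2 k)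
      (tendsto_finsetSum (G.island F k) fun l _ => h2 l)
      (tendsto_finsetSum (G.island F k) fun l _ => h1 l) (e2 _) (e1 _) fun h =>
        (Finset.sum_eq_zero_iff_of_nonneg fun l _ => hp.2 l).1 h k (G.mem_island_self F k))
    filter_upwards [self_mem_nhdsWithin] with q hq
    rw [G.shedDem_eq F hq.2]

/-! ### Stability of the cascade near a unit demand. -/

section Stability

variable {G : PowerGrid N E} {d₀ : N → ℝ} {t : Stage N E}

theorem continuous_flow (G : PowerGrid N E) (F : Finset E) (e : E) :
    Continuous fun q : (N → ℝ) × (N → ℝ) × (N → ℝ) => |G.flow ⟨F, q.2.1, q.2.2⟩ e| := by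
  simp only [flow, Matrix.mulVec, dotProduct, Pi.sub_apply]
  fun_prop

theorem continuous_limit (G : PowerGrid N E) (e : E) :
    Continuous fun q : (N → ℝ) × (N → ℝ) × (N → ℝ) => G.limit q.1 e := by
  simp only [limit, Matrix.mulVec, dotProduct]
  fun_prop

theorem eventually_mem_overloaded (hne : ∀ e, |G.flow t e| ≠ G.limit d₀ e) {e : E}
    (he : e ∈ G.overloaded d₀ t) :
    ∀ᶠ q in 𝓝 (d₀, t.gen, t.dem), e ∈ G.overloaded q.1 ⟨t.failed, q.2.1, q.2.2⟩ := by
  have h : G.limit d₀ e < |G.flow t e| := lt_of_le_of_ne he.2 (hne e).symm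
  filter_upwards [(G.continuous_limit e).continuousAt.eventually_lt
    (G.continuous_flow t.failed e).continuousAt (x₀ := (d₀, t.gen, t.dem)) h] with q hq
  exact ⟨he.1, hq.le⟩

theorem eventually_notMem_overloaded {e : E} (he : e ∉ G.overloaded d₀ t) :
    ∀ᶠ q in 𝓝 (d₀, t.gen, t.dem), e ∉ G.overloaded q.1 ⟨t.failed, q.2.1, q.2.2⟩ := by
  by_cases hF : e ∈ t.failed
  · exact Eventually.of_forall fun q hq => hq.1 hF
  · have h : |G.flow t e| < G.limit d₀ e := lt_of_not_ge fun h => he ⟨hF, h⟩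
    filter_upwards [(G.continuous_flow t.failed e).continuousAt.eventually_lt
      (G.continuous_limit e).continuousAt (x₀ := (d₀, t.gen, t.dem)) h] with q hq hq'
    exact absurd hq'.2 (not_le.2 hq)

/-- Uniqueness makes the comparison with every other overloaded line strict, and lines below their
limit stay below it. Both are open conditions, as the limits are nonzero and the ratios thus
continuous. -/
theorem eventually_eq_of_isNextFailure (hne : ∀ e, |G.flow t e| ≠ G.limit d₀ e)
    (hlim : ∀ e, G.limit d₀ e ≠ 0)
    (huniq : ∀ e e', G.IsNextFailure d₀ t e → G.IsNextFailure d₀ t e' → e = e') {e : E}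
    (he : G.IsNextFailure d₀ t e) :
    ∀ᶠ q in 𝓝 (d₀, t.gen, t.dem), ∀ e',
      G.IsNextFailure q.1 ⟨t.failed, q.2.1, q.2.2⟩ e' → e' = e := by
  refine eventually_all.2 fun e' => ?_
  by_cases hee : e' = e
  · exact Eventually.of_forall fun _ _ => hee
  by_cases hov : e' ∈ G.overloaded d₀ t
  · have hlt : |G.flow t e'| / G.limit d₀ e' < |G.flow t e| / G.limit d₀ e := by
      by_contra hcon
      exact hee (huniq e' e ⟨hov, fun e'' h'' => (he.2 e'' h'').trans (not_lt.1 hcon)⟩ he)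
    have hc : ∀ e, ContinuousAt (fun q : (N → ℝ) × (N → ℝ) × (N → ℝ) =>
        |G.flow ⟨t.failed, q.2.1, q.2.2⟩ e| / G.limit q.1 e) (d₀, t.gen, t.dem) := fun e =>
      (G.continuous_flow t.failed e).continuousAt.div (G.continuous_limit e).continuousAt (hlim e)
    filter_upwards [(hc e').eventually_lt (hc e) hlt, eventually_mem_overloaded hne he.1]
      with q hq hq1 hq2
    exact absurd (hq2.2 e hq1) (not_le.2 hq)
  · filter_upwards [eventually_notMem_overloaded hov] with q hq hq' using absurd hq'.1 hq

theorem exists_isNextFailure {d : N → ℝ} {s : Stage N E} (h : (G.overloaded d s).Nonempty) :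
    ∃ e, G.IsNextFailure d s e := by
  obtain ⟨e, he, hmax⟩ := Set.exists_max_image (G.overloaded d s)
    (fun e => |G.flow s e| / G.limit d e) (Set.toFinite _) h
  exact ⟨e, he, hmax⟩

theorem card_fail_failed {s : Stage N E} {e : E} (h : e ∉ s.failed) :
    (G.fail s e).failed.card = s.failed.card + 1 :=
  Finset.card_insert_of_notMem h

theorem card_fail_first {e : E} {g d : N → ℝ} : (G.fail ⟨∅, g, d⟩ e).failed.card = 1 := by
  simp [fail]

theorem IsStage.card_pos {lam : ℝ} {d : N → ℝ} {e₀ : E} {s : Stage N E}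
    (h : G.IsStage lam d e₀ s) : 0 < s.failed.card := by
  cases h with
  | first g hg => simp [fail]
  | next s e hs he => simp [fail]

/-- Each failure adds exactly one line, so the number of failed lines serves as the stage index; a
stage that is not the last one reached has an overloaded line. -/
theorem IsStage.exists_card_eq {lam : ℝ} {d : N → ℝ} {e₀ : E} {s : Stage N E}
    (h : G.IsStage lam d e₀ s) {j : ℕ} (h0 : 0 < j) (hj : j ≤ s.failed.card) :
    ∃ s', G.IsStage lam d e₀ s' ∧ s'.failed.card = j ∧
      (j < s.failed.card → (G.overloaded d s').Nonempty) := by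
  induction h with
  | first g hg =>
    rw [card_fail_first] at hj
    exact ⟨_, .first g hg, by rw [card_fail_first]; omega, by rw [card_fail_first]; omega⟩
  | next s e hs he ih =>
    rw [card_fail_failed he.1.1] at hj ⊢
    rcases hj.eq_or_lt with rfl | hlt
    · exact ⟨_, .next s e hs he, card_fail_failed he.1.1, fun h => absurd h (lt_irrefl _)⟩
    · rcases (Nat.lt_succ_iff.1 hlt).eq_or_lt with rfl | hlt'
      · exact ⟨s, hs, rfl, fun _ => ⟨e, he.1⟩⟩
      · obtain ⟨s', h1, h2, h3⟩ := ih hlt'.le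
        exact ⟨s', h1, h2, fun _ => h3 hlt'⟩

/-- The stages of the cascades for demands near `d₀` that have as many failed lines as the stage
`t` have the same failed lines as `t`, with generation and demand near those of `t`. -/
def Tracks (G : PowerGrid N E) (lam : ℝ) (d₀ : N → ℝ) (e₀ : E) (t : Stage N E) : Prop :=
  ∀ U ∈ 𝓝[Set.Ici 0] (t.gen, t.dem), ∀ᶠ d in 𝓝[Set.Ici 0] d₀, ∀ s, G.IsStage lam d e₀ s →
    s.failed.card = t.failed.card → s.failed = t.failed ∧ (s.gen, s.dem) ∈ U

theorem Tracks.eventually {lam : ℝ} {e₀ : E} (h : G.Tracks lam d₀ e₀ t)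
    {R : (N → ℝ) → (N → ℝ) × (N → ℝ) → Prop} (hR : ∀ᶠ q in 𝓝 (d₀, t.gen, t.dem), R q.1 q.2) :
    ∀ᶠ d in 𝓝[Set.Ici 0] d₀, ∀ s, G.IsStage lam d e₀ s →
      s.failed.card = t.failed.card → s.failed = t.failed ∧ R d (s.gen, s.dem) := by
  rw [nhds_prod_eq] at hR
  obtain ⟨pa, ha, pb, hb, hab⟩ := eventually_prod_iff.1 hR
  filter_upwards [h _ (nhdsWithin_le_nhds hb), nhdsWithin_le_nhds ha] with d h1 h2 s hs hc
  obtain ⟨h3, h4⟩ := h1 s hs hc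
  exact ⟨h3, hab h2 h4⟩

theorem Tracks.nonneg {lam : ℝ} {e₀ : E} (h : G.Tracks lam d₀ e₀ t) (hd₀ : 0 ≤ d₀)
    (ht : G.IsStage lam d₀ e₀ t) : 0 ≤ (t.gen, t.dem) :=
  ((h _ self_mem_nhdsWithin).self_of_nhdsWithin hd₀ t ht rfl).2

theorem single_nonneg (i : N) : 0 ≤ (Pi.single i 1 : N → ℝ) := Pi.single_nonneg.2 zero_le_one

theorem mixedGen_single_pos {lam : ℝ} (hlam : lam ∈ Set.Ioo (0 : ℝ) 1) (i k : N) :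
    0 < mixedGen lam (Pi.single i 1) k := by
  have : Nonempty N := ⟨i⟩
  have hn : (0 : ℝ) < Fintype.card N := by exact_mod_cast Fintype.card_pos
  rw [mixedGen_single]
  exact add_pos_of_nonneg_of_pos (mul_nonneg (by linarith [hlam.2]) (single_nonneg i k))
    (div_pos hlam.1 hn)

/-- Take `e` itself as first failure: its flow is then zero, and non-degeneracy separates it from
the limit. -/
theorem NonDegenerate.limit_ne_zero {lam : ℝ} (hlam : lam ∈ Set.Ioo (0 : ℝ) 1)
    (hG : G.NonDegenerate lam) (i : N) (e : E) : G.limit (Pi.single i 1) e ≠ 0 := by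
  have h := (hG i e _ (.first _ ((G.isDispatch_single_iff hlam.1.le hlam.2.le).2 rfl))).2 e
  have h0 : G.flow (G.fail ⟨∅, mixedGen lam (Pi.single i 1), Pi.single i 1⟩ e) e = 0 := by
    simp only [flow, ptdf, suscMatrix, fail]
    rw [← Matrix.mulVec_mulVec, ← Matrix.mulVec_mulVec, Matrix.mulVec_diagonal]
    simp
  rw [h0, abs_zero] at h
  exact h.symm

/-- Induction over the stages: neighbourhoods are pulled back through the shedding map, starting
from the dispatch, and the failing line is locally constant. Stages of the wrong kind are excluded
by counting failed lines. -/
theorem NonDegenerate.tracks {lam : ℝ} (hlam : lam ∈ Set.Ioo (0 : ℝ) 1)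
    (hG : G.NonDegenerate lam) {i : N} {e₀ : E} {t : Stage N E}
    (ht : G.IsStage lam (Pi.single i 1) e₀ t) : G.Tracks lam (Pi.single i 1) e₀ t := by
  induction ht with
  | first g hg =>
    rw [G.isDispatch_single_iff hlam.1.le hlam.2.le] at hg
    subst hg
    intro U hU
    have hp : (0 : (N → ℝ) × (N → ℝ)) ≤ (mixedGen lam (Pi.single i 1), Pi.single i 1) :=
      ⟨fun k => (mixedGen_single_pos hlam i k).le, single_nonneg i⟩
    have hU' := (G.tendsto_shed (insert e₀ ∅) hp) hU
    rw [mem_map, mem_nhdsWithin_iff_exists_mem_nhds_inter] at hU'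
    obtain ⟨V, hV, hVU⟩ := hU'
    rw [nhds_prod_eq] at hV
    obtain ⟨V₁, h1, V₂, h2, h12⟩ := mem_prod_iff.1 hV
    -- The dispatch has no sign constraint. Strict positivity of the limit `mixedGen` keeps nearby
    -- dispatches in the cone where shedding is continuous.
    have hpos : {g : N → ℝ | ∀ k, 0 < g k} ∈ 𝓝 (mixedGen lam (Pi.single i 1 : N → ℝ)) :=
      eventually_all.2 fun k => continuousAt_const.eventually_lt
        (continuous_apply k).continuousAt (mixedGen_single_pos hlam i k)
    filter_upwards [self_mem_nhdsWithin, nhdsWithin_le_nhds h2, nhdsWithin_le_nhds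
      (G.eventually_isDispatch_mem hlam.1.le hlam.2.le i (inter_mem h1 hpos))] with d hd hd2 hdg
    intro s hs hc
    rw [card_fail_first] at hc
    cases hs with
    | first g hg =>
      have := hdg g hg
      have hp' : (0 : (N → ℝ) × (N → ℝ)) ≤ (g, d) := ⟨fun k => (this.2 k).le, hd⟩
      exact ⟨rfl, hVU (a := (g, d)) ⟨h12 ⟨this.1, hd2⟩, hp'⟩⟩
    | next s e hs he =>
      rw [card_fail_failed he.1.1] at hc
      have := hs.card_pos
      omega
  | next t e ht he ih =>
    intro U hU
    obtain ⟨huniq, hne⟩ := hG i e₀ t ht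
    have hU' := (G.tendsto_shed (insert e t.failed) (ih.nonneg (single_nonneg i) ht)) hU
    filter_upwards [ih _ hU', ih.eventually (R := fun d p =>
        ∀ e', G.IsNextFailure d ⟨t.failed, p.1, p.2⟩ e' → e' = e)
      (eventually_eq_of_isNextFailure hne (hG.limit_ne_zero hlam i) huniq he)] with d h1 h2
    intro s hs hc
    rw [card_fail_failed he.1.1] at hc
    cases hs with
    | first g hg =>
      rw [card_fail_first] at hc
      have := ht.card_pos
      omega
    | next s e' hs he' =>
      rw [card_fail_failed he'.1.1] at hc
      have hc' : s.failed.card = t.failed.card := by omega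
      obtain ⟨h3, h4⟩ := h1 s hs hc'
      obtain ⟨-, h5⟩ := h2 s hs hc'
      obtain ⟨F, g, dm⟩ := s
      obtain rfl : F = t.failed := h3
      obtain rfl := h5 e' he'
      exact ⟨rfl, h4⟩

theorem NonDegenerate.exists_final {lam : ℝ} (hlam : lam ∈ Set.Ioo (0 : ℝ) 1)
    (hG : G.NonDegenerate lam) (i : N) (e₀ : E) :
    ∃ F₀, G.IsFinalFailure lam (Pi.single i 1) e₀ F₀ ∧
      ∀ᶠ d in 𝓝[Set.Ici 0] (Pi.single i 1 : N → ℝ), ∀ F, G.IsFinalFailure lam d e₀ F → F = F₀ := by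
  obtain ⟨t, ht, htmax⟩ : ∃ t, G.IsStage lam (Pi.single i 1) e₀ t ∧
      G.overloaded (Pi.single i 1) t = ∅ := by
    -- If no stage were terminal, the number of failed lines would grow beyond the number of lines.
    by_contra! hcon
    have : ∀ j : ℕ, ∃ t, G.IsStage lam (Pi.single i 1) e₀ t ∧ j ≤ t.failed.card := by
      intro j
      induction j with
      | zero =>
        exact ⟨_, .first _ ((G.isDispatch_single_iff hlam.1.le hlam.2.le).2 rfl), Nat.zero_le _⟩
      | succ j ih =>
        obtain ⟨t, ht, hj⟩ := ih
        obtain ⟨e, he⟩ := exists_isNextFailure (hcon t ht)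
        exact ⟨_, .next t e ht he, by rw [card_fail_failed he.1.1]; omega⟩
    obtain ⟨t, -, ht⟩ := this (Fintype.card E + 1)
    have := Finset.card_le_univ t.failed
    omega
  refine ⟨t.failed, ⟨t, ht, htmax, rfl⟩, ?_⟩
  -- Nearby cascades cannot stop early, since an overload of the limiting cascade persists at each
  -- earlier stage.
  have hlt : ∀ᶠ d in 𝓝[Set.Ici 0] (Pi.single i 1 : N → ℝ), ∀ j ∈ Finset.range t.failed.card,
      ∀ s, G.IsStage lam d e₀ s → s.failed.card = j → (G.overloaded d s).Nonempty := by
    rw [eventually_all_finset]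
    intro j hj
    rw [Finset.mem_range] at hj
    rcases Nat.eq_zero_or_pos j with rfl | hj0
    · exact Eventually.of_forall fun d s hs hc => absurd hs.card_pos (by omega)
    obtain ⟨u, hu, huc, hun⟩ := ht.exists_card_eq hj0 hj.le
    obtain ⟨e, he⟩ := hun hj
    filter_upwards [(hG.tracks hlam hu).eventually (R := fun d p =>
      e ∈ G.overloaded d ⟨u.failed, p.1, p.2⟩)
      (eventually_mem_overloaded (hG i e₀ u hu).2 he)] with d hd s hs hc
    obtain ⟨h1, h2⟩ := hd s hs (hc.trans huc.symm)
    rw [← h1] at h2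
    exact ⟨e, h2⟩
  have hov : ∀ᶠ q in 𝓝 ((Pi.single i 1 : N → ℝ), t.gen, t.dem), ∀ e,
      e ∉ G.overloaded q.1 ⟨t.failed, q.2.1, q.2.2⟩ :=
    eventually_all.2 fun e => eventually_notMem_overloaded (by rw [htmax]; exact fun h => h)
  filter_upwards [hlt, (hG.tracks hlam ht).eventually (R := fun d p =>
      ∀ e, e ∉ G.overloaded d ⟨t.failed, p.1, p.2⟩) hov] with d h1 h2
  rintro F ⟨s, hs, hso, rfl⟩
  rcases lt_trichotomy s.failed.card t.failed.card with h | h | h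
  · have := h1 _ (Finset.mem_range.2 h) s hs rfl
    rw [hso] at this
    exact absurd this Set.not_nonempty_empty
  · exact (h2 s hs h).1
  -- A longer cascade would pass through a stage with as many failures as `t` and an overload there,
  -- but near `t` there is none.
  · obtain ⟨s', hs', hc', hn'⟩ := hs.exists_card_eq ht.card_pos h.le
    obtain ⟨h3, h4⟩ := h2 s' hs' hc'
    obtain ⟨e, he⟩ := hn' h
    rw [← h3] at h4
    exact absurd he (h4 e)

end Stability

/-! ### Homogeneity of the model. -/

section Scaling

variable {G : PowerGrid N E} {lam c : ℝ} {d g : N → ℝ}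

theorem IsFeasible.smul (hc : 0 ≤ c) (h : G.IsFeasible lam d g) :
    G.IsFeasible lam (c • d) (c • g) := by
  refine ⟨?_, fun e => ?_⟩
  · simp only [Pi.smul_apply, smul_eq_mul, ← Finset.mul_sum, h.1]
  · rw [← smul_sub, Matrix.mulVec_smul, Matrix.mulVec_smul]
    simp only [Pi.smul_apply, smul_eq_mul, abs_mul, abs_of_nonneg hc]
    have := mul_le_mul_of_nonneg_left (h.2 e) hc
    linarith

theorem IsDispatch.smul (hc : 0 < c) (h : G.IsDispatch lam d g) :
    G.IsDispatch lam (c • d) (c • g) := by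
  refine ⟨h.1.smul hc.le, fun g' hg' => ?_⟩
  -- A competitor for `c • d` is scaled back to one for `d`; costs scale by `c ^ 2`.
  have h1 := hg'.smul (inv_nonneg.2 hc.le)
  rw [inv_smul_smul₀ hc.ne'] at h1
  have h2 := mul_le_mul_of_nonneg_left (h.2 _ h1) (sq_nonneg c)
  rw [Finset.mul_sum, Finset.mul_sum] at h2
  refine le_trans (le_of_eq ?_) (h2.trans (le_of_eq ?_)) <;> refine Finset.sum_congr rfl fun k _ => ?_
  · simp; ring
  · simp; field_simp

/-- The stage with generation and demand scaled by `c`. -/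
def Stage.scale (c : ℝ) (s : Stage N E) : Stage N E := ⟨s.failed, c • s.gen, c • s.dem⟩

theorem imbalance_smul (F : Finset E) (k : N) :
    G.imbalance F (c • g) (c • d) k = c * G.imbalance F g d k := by
  simp only [imbalance, Finset.mul_sum, Pi.smul_apply, smul_eq_mul, mul_sub]

theorem fail_scale (hc : 0 < c) (s : Stage N E) (e : E) :
    G.fail (s.scale c) e = (G.fail s e).scale c := by
  simp only [fail, Stage.scale, Stage.mk.injEq, true_and]
  constructor
  · ext k
    simp only [shedGen, imbalance_smul, mul_neg_iff, hc, hc.not_gt, Pi.smul_apply, smul_eq_mul,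
      ← Finset.mul_sum, mul_div_mul_left _ _ hc.ne', true_and, false_and, or_false]
    split_ifs <;> ring
  · ext k
    simp only [shedDem, imbalance_smul, mul_neg_iff, hc, hc.not_gt, Pi.smul_apply, smul_eq_mul,
      ← Finset.mul_sum, abs_mul, abs_of_pos hc, mul_div_mul_left _ _ hc.ne', true_and, false_and,
      or_false]
    split_ifs <;> ring

theorem abs_flow_scale (hc : 0 < c) (s : Stage N E) (e : E) :
    |G.flow (s.scale c) e| = c * |G.flow s e| := by
  simp only [flow, Stage.scale, ← smul_sub, Matrix.mulVec_smul, Pi.smul_apply, smul_eq_mul,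
    abs_mul, abs_of_pos hc]

theorem limit_smul (hc : 0 < c) (e : E) : G.limit (c • d) e = c * G.limit d e := by
  simp only [limit, Matrix.mulVec_smul, Pi.smul_apply, smul_eq_mul, abs_mul, abs_of_pos hc]

theorem overloaded_scale (hc : 0 < c) (s : Stage N E) :
    G.overloaded (c • d) (s.scale c) = G.overloaded d s := by
  ext e
  simp only [overloaded, Set.mem_ofPred_eq, abs_flow_scale hc, limit_smul hc,
    mul_le_mul_iff_right₀ hc]
  rfl

theorem IsNextFailure.scale (hc : 0 < c) {s : Stage N E} {e : E} (h : G.IsNextFailure d s e) :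
    G.IsNextFailure (c • d) (s.scale c) e := by
  simpa only [IsNextFailure, overloaded_scale hc, abs_flow_scale hc, limit_smul hc,
    mul_div_mul_left _ _ hc.ne'] using h

theorem IsStage.scale (hc : 0 < c) {e₀ : E} {s : Stage N E} (h : G.IsStage lam d e₀ s) :
    G.IsStage lam (c • d) e₀ (s.scale c) := by
  induction h with
  | first g hg =>
    rw [← fail_scale hc]
    exact .first _ (hg.smul hc)
  | next s e hs he ih =>
    rw [← fail_scale hc]
    exact .next _ e ih (he.scale hc)

theorem IsFinalFailure.smul (hc : 0 < c) {e₀ : E} {F : Finset E}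
    (h : G.IsFinalFailure lam d e₀ F) : G.IsFinalFailure lam (c • d) e₀ F := by
  obtain ⟨s, h1, h2, h3⟩ := h
  exact ⟨s.scale c, h1.scale hc, by rw [overloaded_scale hc, h2], h3⟩

theorem IsBlackoutSize.smul (hc : 0 < c) {e₀ : E} {s : ℝ} (h : G.IsBlackoutSize lam d e₀ s) :
    G.IsBlackoutSize lam (c • d) e₀ (c * s) := by
  obtain ⟨g, F, i, h1, h2, h3, rfl⟩ := h
  refine ⟨c • g, F, i, h1.smul hc, h2.smul hc, fun k => mul_le_mul_of_nonneg_left (h3 k) hc.le, ?_⟩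
  rw [← abs_of_pos hc, ← abs_mul, abs_of_pos hc, Finset.mul_sum]
  simp only [Pi.smul_apply, smul_eq_mul, mul_sub]

end Scaling

/-! ### Blackout size under one dominant demand. -/

section BlackoutSize

variable {G : PowerGrid N E} {lam : ℝ}

theorem numCutOff_eq {i : N} {e₀ : E} {F₀ : Finset E}
    (h : G.IsFinalFailure lam (Pi.single i 1) e₀ F₀)
    (huniq : ∀ F, G.IsFinalFailure lam (Pi.single i 1) e₀ F → F = F₀) :
    (G.numCutOff lam i e₀ : ℝ) = Fintype.card N - (G.island F₀ i).card := by
  have hset : {k | ∃ F, G.IsFinalFailure lam (Pi.single i 1) e₀ F ∧ k ∉ G.island F i} =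
      ((G.island F₀ i)ᶜ : Finset N) := by
    ext k
    simp only [Set.mem_ofPred_eq, Finset.coe_compl, Set.mem_compl_iff, Finset.mem_coe]
    exact ⟨fun ⟨F, hF, hk⟩ => huniq F hF ▸ hk, fun hk => ⟨F₀, h, hk⟩⟩
  rw [numCutOff, hset, Set.ncard_coe_finset, Finset.card_compl,
    Nat.cast_sub (Finset.card_le_univ _)]

/-- For demands near a single sink, the size of the blackout is near that for the single sink, and
it is zero if the cascade for the single sink cuts off no node. -/
theorem NonDegenerate.eventually_blackoutSize (hlam : lam ∈ Set.Ioo (0 : ℝ) 1)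
    (hG : G.NonDegenerate lam) (i : N) (e₀ : E) {δ : ℝ} (hδ : 0 < δ) :
    ∀ᶠ d in 𝓝[Set.Ici 0] (Pi.single i 1 : N → ℝ), ∀ s, G.IsBlackoutSize lam d e₀ s →
      |s - G.numCutOff lam i e₀ * lam / Fintype.card N| ≤ δ ∧
        (G.numCutOff lam i e₀ = 0 → s = 0) := by
  have : Nonempty N := ⟨i⟩
  have hn : (Fintype.card N : ℝ) ≠ 0 := by exact_mod_cast Fintype.card_ne_zero
  obtain ⟨F₀, hF₀, hev⟩ := hG.exists_final hlam i e₀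
  have hZ := numCutOff_eq hF₀ (hev.self_of_nhdsWithin (single_nonneg i))
  set f : (N → ℝ) × (N → ℝ) → ℝ := fun p => |∑ k ∈ G.island F₀ i, (p.1 k - p.2 k)| with hf
  have hfc : Continuous f := by fun_prop
  have hf0 : f (Pi.single i 1, mixedGen lam (Pi.single i 1)) =
      G.numCutOff lam i e₀ * lam / Fintype.card N := by
    have h1 : ∑ k ∈ G.island F₀ i, ((Pi.single i 1 : N → ℝ) k - mixedGen lam (Pi.single i 1) k) =
        G.numCutOff lam i e₀ * lam / Fintype.card N := by
      have h2 : ∀ k, (Pi.single i 1 : N → ℝ) k - mixedGen lam (Pi.single i 1) k =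
          lam * (Pi.single i 1 : N → ℝ) k - lam / Fintype.card N := by
        intro k; rw [mixedGen_single]; ring
      simp only [h2, Finset.sum_sub_distrib, ← Finset.mul_sum, Finset.sum_pi_single', hZ,
        G.mem_island_self, if_true, Finset.sum_const, nsmul_eq_mul]
      field_simp
    rw [hf]
    simp only [h1]
    refine abs_of_nonneg (div_nonneg (mul_nonneg (Nat.cast_nonneg _) hlam.1.le) (Nat.cast_nonneg _))
  have hnear : ∀ᶠ p in 𝓝 ((Pi.single i 1 : N → ℝ), mixedGen lam (Pi.single i 1 : N → ℝ)),
      |f p - G.numCutOff lam i e₀ * lam / Fintype.card N| < δ := by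
    have := (hfc.tendsto (Pi.single i 1, mixedGen lam (Pi.single i 1))).eventually
      (Metric.ball_mem_nhds _ hδ)
    rw [hf0] at this
    exact this
  rw [nhds_prod_eq] at hnear
  obtain ⟨pa, ha, pb, hb, hab⟩ := eventually_prod_iff.1 hnear
  -- Near the unit demand the largest city is unambiguously `i`, so the measured island is that of
  -- `i`.
  have hmax : ∀ᶠ d in 𝓝 (Pi.single i 1 : N → ℝ), ∀ k, k ≠ i → d k < d i := by
    refine eventually_all.2 fun k => ?_
    by_cases hk : k = i
    · exact Eventually.of_forall fun _ h => absurd hk h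
    · filter_upwards [(continuous_apply k).continuousAt.eventually_lt
        (continuous_apply i).continuousAt (x₀ := (Pi.single i 1 : N → ℝ)) (by simp [hk])]
        with d hd _ using hd
  filter_upwards [hev, nhdsWithin_le_nhds ha, nhdsWithin_le_nhds hmax, nhdsWithin_le_nhds
    (G.eventually_isDispatch_mem hlam.1.le hlam.2.le i hb)] with d h1 h2 h3 h4
  rintro s ⟨g, F, j, hg, hF, hj, rfl⟩
  obtain rfl : j = i := by
    by_contra hne
    exact absurd (hj i) (not_le.2 (h3 j hne))
  obtain rfl := h1 F hF
  refine ⟨(hab h2 (h4 g hg)).le, fun h0 => ?_⟩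
  -- With no node cut off, the island is the whole grid, and power balance makes the sum exactly
  -- zero.
  have hcard : (G.island F j).card = Fintype.card N := by
    rw [h0] at hZ
    have : (Fintype.card N : ℝ) = (G.island F j).card := by
      push_cast at hZ; linarith
    exact_mod_cast this.symm
  rw [Finset.card_eq_iff_eq_univ] at hcard
  rw [hcard, Finset.sum_sub_distrib, hg.1.1, sub_self, abs_zero]

/-- Dividing by `x i` brings the demand close to the unit vector; homogeneity carries the local
estimate back. -/
theorem NonDegenerate.exists_blackoutSize (hlam : lam ∈ Set.Ioo (0 : ℝ) 1)
    (hG : G.NonDegenerate lam) (i : N) (e₀ : E) {δ : ℝ} (hδ : 0 < δ) :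
    ∃ ε > 0, ∀ x : N → ℝ, 0 ≤ x → 0 < x i → (∀ k, k ≠ i → x k ≤ ε * x i) →
      ∀ s, G.IsBlackoutSize lam x e₀ s →
        |s - x i * (G.numCutOff lam i e₀ * lam / Fintype.card N)| ≤ δ * x i ∧
          (G.numCutOff lam i e₀ = 0 → s = 0) := by
  obtain ⟨ε, hε, h⟩ := Metric.eventually_nhds_iff.1
    (eventually_nhdsWithin_iff.1 (hG.eventually_blackoutSize hlam i e₀ hδ))
  refine ⟨ε / 2, half_pos hε, fun x hx0 hxi hx s hs => ?_⟩
  have hdist : dist ((x i)⁻¹ • x) (Pi.single i 1) < ε := by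
    refine lt_of_le_of_lt ?_ (half_lt_self hε)
    rw [dist_pi_le_iff (half_pos hε).le]
    intro k
    by_cases hk : k = i
    · subst hk
      simpa [hxi.ne'] using (half_pos hε).le
    · simp only [Pi.smul_apply, smul_eq_mul, Pi.single_eq_of_ne hk, dist_zero_right,
        Real.norm_eq_abs]
      rw [abs_of_nonneg (mul_nonneg (inv_nonneg.2 hxi.le) (hx0 k)), inv_mul_le_iff₀ hxi]
      linarith [hx k hk]
  obtain ⟨h1, h2⟩ := h hdist (smul_nonneg (inv_nonneg.2 hxi.le) hx0) _
    (hs.smul (inv_pos.2 hxi))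
  refine ⟨?_, fun h0 => ?_⟩
  · have h3 := mul_le_mul_of_nonneg_left h1 hxi.le
    rw [← abs_of_pos hxi, ← abs_mul, abs_of_pos hxi, mul_sub, mul_inv_cancel_left₀ hxi.ne'] at h3
    linarith
  · exact (mul_eq_zero.1 (h2 h0)).resolve_left (inv_pos.2 hxi).ne'

/-- The dispatch has norm at most that of `mixedGen`, whose entries lie between zero and the largest
demand. This crude linear bound is all that is needed when no sharper approximation is available. -/
theorem IsBlackoutSize.exists_le (h0 : 0 ≤ lam) (h1 : lam ≤ 1) {x : N → ℝ} (hx : 0 ≤ x) {e₀ : E}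
    {s : ℝ} (h : G.IsBlackoutSize lam x e₀ s) :
    ∃ i, (∀ k, x k ≤ x i) ∧ s ≤ (Fintype.card N + (Fintype.card N : ℝ) ^ 2) * x i := by
  obtain ⟨g, F, i, hg, -, hmax, rfl⟩ := h
  refine ⟨i, hmax, ?_⟩
  have : Nonempty N := ⟨i⟩
  have hn : (1 : ℝ) ≤ Fintype.card N := by exact_mod_cast Fintype.card_pos
  have hM : 0 ≤ x i := hx i
  have hmix : ∀ k, mixedGen lam x k ^ 2 ≤ x i ^ 2 := by
    intro k
    have h2 : 0 ≤ (∑ l, x l) / Fintype.card N :=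
      div_nonneg (Finset.sum_nonneg fun l _ => hx l) (by linarith)
    have h3 : (∑ l, x l) / Fintype.card N ≤ x i := by
      rw [div_le_iff₀ (by linarith)]
      have := Finset.sum_le_card_nsmul Finset.univ x (x i) fun k _ => hmax k
      rw [nsmul_eq_mul, Finset.card_univ] at this
      linarith
    have h4 : 0 ≤ mixedGen lam x k :=
      add_nonneg (mul_nonneg (by linarith) (hx k)) (mul_nonneg h0 h2)
    refine pow_le_pow_left₀ h4 ?_ 2
    have h5 := mul_le_mul_of_nonneg_left (hmax k) (sub_nonneg.2 h1)
    have h6 := mul_le_mul_of_nonneg_left h3 h0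
    rw [mixedGen]
    linarith
  have hgk : ∀ k, |g k| ≤ Fintype.card N * x i := by
    intro k
    refine abs_le_of_sq_le_sq ?_ (mul_nonneg (by linarith) hM)
    have h2 := Finset.single_le_sum (f := fun k => g k ^ 2) (fun _ _ => sq_nonneg _)
      (Finset.mem_univ k)
    have h3 := Finset.sum_le_card_nsmul Finset.univ _ (x i ^ 2) fun k _ => hmix k
    rw [nsmul_eq_mul, Finset.card_univ] at h3
    have h4 := h2.trans ((hg.sum_sq_le h0).trans h3)
    refine h4.trans ?_
    rw [mul_pow]
    refine mul_le_mul_of_nonneg_right ?_ (sq_nonneg _)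
    nlinarith
  calc |∑ k ∈ G.island F i, (x k - g k)| ≤ ∑ k ∈ G.island F i, |x k - g k| :=
        Finset.abs_sum_le_sum_abs _ _
    _ ≤ ∑ k, |x k - g k| := Finset.sum_le_univ_sum_of_nonneg fun _ => abs_nonneg _
    _ ≤ ∑ _k : N, (x i + Fintype.card N * x i) := by
        refine Finset.sum_le_sum fun k _ => (abs_sub _ _).trans (add_le_add ?_ (hgk k))
        rw [abs_of_nonneg (hx k)]
        exact hmax k
    _ = (Fintype.card N + (Fintype.card N : ℝ) ^ 2) * x i := by
        rw [Finset.sum_const, Finset.card_univ, nsmul_eq_mul]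
        ring

end BlackoutSize

end PowerGrid

/-! ### Pareto tails and joint exceedances. -/

theorem paretoMeasure_real_Ioi {t r y : ℝ} (ht : 0 < t) (hr : 0 < r) (hy : t ≤ y) :
    (paretoMeasure t r).real (Set.Ioi y) = t ^ r * y ^ (-r) := by
  have hy0 : 0 < y := ht.trans_le hy
  have h1 : (paretoMeasure t r).real (Set.Ioi y) = ∫ x in Set.Ioi y, paretoPDFReal t r x := by
    rw [paretoMeasure, measureReal_def, withDensity_apply _ measurableSet_Ioi]
    refine (integral_eq_lintegral_of_nonneg_ae ?_ ?_).symm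
    · exact ae_of_all _ fun _ => paretoPDFReal_nonneg ht.le hr.le _
    · exact (measurable_paretoPDFReal t r).aestronglyMeasurable
  have h2 : ∫ x in Set.Ioi y, paretoPDFReal t r x =
      ∫ x in Set.Ioi y, r * t ^ r * x ^ (-(r + 1)) := by
    refine setIntegral_congr_fun measurableSet_Ioi fun x hx => ?_
    simp only [paretoPDFReal, if_pos (hy.trans (le_of_lt hx))]
  rw [h1, h2, integral_const_mul, integral_Ioi_rpow_of_lt (by linarith) hy0]
  have h3 : -(r + 1) + 1 = -r := by ring
  rw [h3]
  field_simp

theorem paretoMeasure_Iio {t r : ℝ} : paretoMeasure t r (Set.Iio t) = 0 := by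
  rw [paretoMeasure, withDensity_apply _ measurableSet_Iio, lintegral_paretoPDF_of_le le_rfl]

section Tail

variable {N E Ω : Type*} [Fintype N] [DecidableEq N] [Fintype E] [DecidableEq E]
  [MeasurableSpace E] [DiscreteMeasurableSpace E] [MeasurableSpace Ω]
  {μ : Measure Ω} [IsProbabilityMeasure μ] {xmin α : ℝ} {X : N → Ω → ℝ} {ℓ : Ω → E} {S : Ω → ℝ}

theorem ae_le_of_map_eq_paretoMeasure {Y : Ω → ℝ} (hY : Measurable Y)
    (hlaw : μ.map Y = paretoMeasure xmin α) : ∀ᵐ ω ∂μ, xmin ≤ Y ω := by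
  have h := paretoMeasure_Iio (t := xmin) (r := α)
  rw [← hlaw, Measure.map_apply hY measurableSet_Iio] at h
  filter_upwards [measure_eq_zero_iff_ae_notMem.1 h] with ω hω
  exact not_lt.1 hω

theorem measureReal_lt_of_map_eq_paretoMeasure (hxmin : 0 < xmin) (hα : 0 < α) {Y : Ω → ℝ}
    (hY : Measurable Y) (hlaw : μ.map Y = paretoMeasure xmin α) {y : ℝ} (hy : xmin ≤ y) :
    μ.real {ω | y < Y ω} = xmin ^ α * y ^ (-α) := by
  rw [← paretoMeasure_real_Ioi hxmin hα hy, ← hlaw, map_measureReal_apply hY measurableSet_Ioi]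
  rfl

theorem measureReal_lt_le_of_map_eq_paretoMeasure (hxmin : 0 < xmin) (hα : 0 < α) {Y : Ω → ℝ}
    (hY : Measurable Y) (hlaw : μ.map Y = paretoMeasure xmin α) {y : ℝ} (hy : 0 < y) :
    μ.real {ω | y < Y ω} ≤ xmin ^ α * y ^ (-α) := by
  rcases le_total xmin y with h | h
  · exact (measureReal_lt_of_map_eq_paretoMeasure hxmin hα hY hlaw h).le
  -- Below `xmin` the power expression is at least its value `1` at `xmin`, so the bound is trivial.
  · refine measureReal_le_one.trans ?_
    have h1 := Real.rpow_le_rpow_of_nonpos hy h (neg_nonpos.2 hα.le)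
    calc (1 : ℝ) = xmin ^ α * xmin ^ (-α) := by
          rw [← Real.rpow_add hxmin, add_neg_cancel, Real.rpow_zero]
      _ ≤ xmin ^ α * y ^ (-α) := mul_le_mul_of_nonneg_left h1 (Real.rpow_nonneg hxmin.le _)

/-- The event that two different variables exceed `y`. -/
def twoExceed (X : N → Ω → ℝ) (y : ℝ) : Set Ω :=
  ⋃ p ∈ (Finset.univ.filter fun p : N × N => p.1 ≠ p.2), {ω | y < X p.1 ω} ∩ {ω | y < X p.2 ω}

theorem mem_twoExceed {y : ℝ} {ω : Ω} :
    ω ∈ twoExceed X y ↔ ∃ i j, i ≠ j ∧ y < X i ω ∧ y < X j ω := by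
  simp [twoExceed, and_left_comm]

theorem measurableSet_twoExceed (hX : ∀ k, Measurable (X k)) (y : ℝ) :
    MeasurableSet (twoExceed X y) :=
  Finset.measurableSet_biUnion _ fun p _ =>
    (measurableSet_lt measurable_const (hX p.1)).inter (measurableSet_lt measurable_const (hX p.2))

theorem measureReal_twoExceed_le (hxmin : 0 < xmin) (hα : 0 < α) (hX : ∀ k, Measurable (X k))
    (hXlaw : ∀ k, μ.map (X k) = paretoMeasure xmin α) (hXindep : iIndepFun X μ) {y : ℝ}
    (hy : 0 < y) :
    μ.real (twoExceed X y) ≤ (Fintype.card N : ℝ) ^ 2 * (xmin ^ α * y ^ (-α)) ^ 2 := by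
  have hb : 0 ≤ xmin ^ α * y ^ (-α) :=
    mul_nonneg (Real.rpow_nonneg hxmin.le _) (Real.rpow_nonneg hy.le _)
  calc μ.real (twoExceed X y)
      ≤ ∑ p ∈ (Finset.univ.filter fun p : N × N => p.1 ≠ p.2),
          μ.real ({ω | y < X p.1 ω} ∩ {ω | y < X p.2 ω}) := measureReal_biUnion_finset_le _ _
    _ ≤ ∑ p ∈ (Finset.univ.filter fun p : N × N => p.1 ≠ p.2), (xmin ^ α * y ^ (-α)) ^ 2 := by
        refine Finset.sum_le_sum fun p hp => ?_
        have hne : p.1 ≠ p.2 := (Finset.mem_filter.1 hp).2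
        have h := (hXindep.indepFun hne).measure_inter_preimage_eq_mul (Set.Ioi y) (Set.Ioi y)
          measurableSet_Ioi measurableSet_Ioi
        have h' : μ.real ({ω | y < X p.1 ω} ∩ {ω | y < X p.2 ω}) =
            μ.real {ω | y < X p.1 ω} * μ.real {ω | y < X p.2 ω} := by
          simp only [measureReal_def, ← ENNReal.toReal_mul]
          exact congrArg ENNReal.toReal h
        rw [h', sq]
        exact mul_le_mul (measureReal_lt_le_of_map_eq_paretoMeasure hxmin hα (hX _) (hXlaw _) hy)
          (measureReal_lt_le_of_map_eq_paretoMeasure hxmin hα (hX _) (hXlaw _) hy)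
          measureReal_nonneg hb
    _ ≤ ∑ _p : N × N, (xmin ^ α * y ^ (-α)) ^ 2 :=
        Finset.sum_le_univ_sum_of_nonneg fun _ => sq_nonneg _
    _ = _ := by simp [sq]

theorem measureReal_eq_and_lt (hxmin : 0 < xmin) (hα : 0 < α) (hX : ∀ k, Measurable (X k))
    (hXlaw : ∀ k, μ.map (X k) = paretoMeasure xmin α)
    (hℓ : Measurable ℓ) (hℓlaw : μ.map ℓ = uniformOn Set.univ)
    (hℓindep : IndepFun (fun ω k => X k ω) ℓ μ) (i : N) (e : E) {b x : ℝ} (hb : 0 < b)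
    (hx : xmin * b ≤ x) :
    μ.real {ω | ℓ ω = e ∧ x < b * X i ω} =
      xmin ^ α / Fintype.card E * b ^ α * x ^ (-α) := by
  have hx0 : 0 < x := (mul_pos hxmin hb).trans_le hx
  have hind : IndepFun (X i) ℓ μ := hℓindep.comp (measurable_pi_apply i) measurable_id
  have h := hind.measure_inter_preimage_eq_mul (Set.Ioi (x / b)) {e}
          measurableSet_Ioi (MeasurableSet.of_discrete)
  have hset : {ω | ℓ ω = e ∧ x < b * X i ω} = X i ⁻¹' Set.Ioi (x / b) ∩ ℓ ⁻¹' {e} := by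
    ext ω
    simp only [Set.mem_ofPred_eq, Set.mem_inter_iff, Set.mem_preimage, Set.mem_Ioi,
      Set.mem_singleton_iff, div_lt_iff₀' hb]
    exact and_comm
  have h1 : μ.real (X i ⁻¹' Set.Ioi (x / b)) = xmin ^ α * (x / b) ^ (-α) :=
    measureReal_lt_of_map_eq_paretoMeasure hxmin hα (hX i) (hXlaw i) ((le_div_iff₀ hb).2 hx)
  have h2 : μ.real (ℓ ⁻¹' {e}) = 1 / Fintype.card E := by
    rw [← map_measureReal_apply hℓ MeasurableSet.of_discrete, hℓlaw, measureReal_def,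
      uniformOn_univ]
    simp
  rw [hset, measureReal_def, h, ENNReal.toReal_mul, ← measureReal_def, ← measureReal_def, h1, h2,
    Real.div_rpow hx0.le hb.le, Real.rpow_neg hb.le]
  field_simp

theorem measureReal_mono_ae {s t : Set Ω} (h : ∀ᵐ ω ∂μ, ω ∈ s → ω ∈ t) :
    μ.real s ≤ μ.real t :=
  ENNReal.toReal_mono (measure_ne_top _ _) (measure_mono_ae h)

/-! ### The single-big-jump principle. -/

/-- `S` is of size at most `c * max X`, and close to `a i e * X i` when `X i` dominates the other
variables and `ℓ = e`, with equality if `a i e = 0`. -/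
structure DominatedByMax (μ : Measure Ω) (X : N → Ω → ℝ) (ℓ : Ω → E) (S : Ω → ℝ) (a : N × E → ℝ)
    (c : ℝ) : Prop where
  le_max : ∀ᵐ ω ∂μ, ∃ i, (∀ k, X k ω ≤ X i ω) ∧ S ω ≤ c * X i ω
  local_approx : ∀ p, ∀ δ > 0, ∃ ε > 0, ∀ᵐ ω ∂μ, ℓ ω = p.2 → 0 < X p.1 ω →
    (∀ k, k ≠ p.1 → X k ω ≤ ε * X p.1 ω) →
      |S ω - X p.1 ω * a p| ≤ δ * X p.1 ω ∧ (a p = 0 → S ω = 0)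
  coeff_nonneg : ∀ p, 0 ≤ a p
  coeff_le : ∀ p, a p ≤ c
  const_pos : 0 < c

namespace DominatedByMax

variable {a : N × E → ℝ} {c : ℝ}

/-- There are finitely many pairs, so a common `ε` exists; `ε ≤ 1` lets one threshold serve both for
the dominant variable and for the others. -/
theorem exists_forall_approx (h : DominatedByMax μ X ℓ S a c) {δ : ℝ} (hδ : 0 < δ) :
    ∃ ε > 0, ε ≤ 1 ∧ ∀ᵐ ω ∂μ, ∀ p, ℓ ω = p.2 → 0 < X p.1 ω →
      (∀ k, k ≠ p.1 → X k ω ≤ ε * X p.1 ω) →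
        |S ω - X p.1 ω * a p| ≤ δ * X p.1 ω ∧ (a p = 0 → S ω = 0) := by
  choose ε hε hae using fun p => h.local_approx p δ hδ
  obtain ⟨ε₀, h0, h1⟩ : ∃ ε₀ > 0, ε₀ ≤ 1 ∧ ∀ p, ε₀ ≤ ε p := by
    have h2 : ∀ᶠ ε₀ in 𝓝[>] (0 : ℝ), 0 < ε₀ ∧ ε₀ ≤ 1 ∧ ∀ p, ε₀ ≤ ε p := by
      have h3 : ∀ᶠ ε₀ in 𝓝[>] (0 : ℝ), ∀ p, ε₀ ≤ ε p := eventually_all.2 fun p =>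
        nhdsWithin_le_nhds (eventually_le_nhds (hε p))
      filter_upwards [self_mem_nhdsWithin, nhdsWithin_le_nhds (eventually_le_nhds zero_lt_one), h3]
        with x hx1 hx2 hx3 using ⟨hx1, hx2, hx3⟩
    obtain ⟨ε₀, h4, h5⟩ := h2.exists
    exact ⟨ε₀, h4, h5⟩
  refine ⟨ε₀, h0, h1.1, ?_⟩
  filter_upwards [ae_all_iff.2 hae] with ω hω p hp hpos hk
  exact hω p hp hpos fun k hne => (hk k hne).trans (mul_le_mul_of_nonneg_right (h1.2 p) hpos.le)

/-- Up to the event that two variables are large, the tail event of `S` is that of `a i e * X i`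
for some `i` and `e = ℓ`. -/
theorem exists_sandwich (h : DominatedByMax μ X ℓ S a c) {δ : ℝ} (hδ : 0 < δ) :
    ∃ η > 0, ∀ x > 0,
      (∀ᵐ ω ∂μ, x < S ω → ω ∈ twoExceed X (η * x) ∨
        ∃ p, a p ≠ 0 ∧ ℓ ω = p.2 ∧ x < (a p + δ) * X p.1 ω) ∧
      (∀ᵐ ω ∂μ, ∀ p, δ < a p → ℓ ω = p.2 → x < (a p - δ) * X p.1 ω → ω ∉ twoExceed X (η * x) →
        x < S ω) ∧
      ∀ ω p, δ < a p → x < (a p - δ) * X p.1 ω → η * x < X p.1 ω := by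
  obtain ⟨ε, hε, hε1, hae⟩ := h.exists_forall_approx hδ
  have hc := h.const_pos
  -- The threshold `ε / c * x` is chosen so that any variable below it is at most `ε` times a
  -- variable `y` with `x < b * y`, `b ≤ c`.
  have key : ∀ {b y x : ℝ}, 0 < b → b ≤ c → 0 < x → x < b * y → ε / c * x < ε * y := by
    intro b y x hb hbc hx hxy
    have hy : 0 < y := pos_of_mul_pos_right (hx.trans hxy) hb.le
    rw [div_mul_eq_mul_div, div_lt_iff₀ hc, mul_assoc]
    refine mul_lt_mul_of_pos_left (hxy.trans_le ?_) hε
    rw [mul_comm y]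
    exact mul_le_mul_of_nonneg_right hbc hy.le
  have key2 : ∀ {b y x : ℝ}, 0 < b → b ≤ c → 0 < x → x < b * y → ε / c * x < y := by
    intro b y x hb hbc hx hxy
    have hy : 0 < y := pos_of_mul_pos_right (hx.trans hxy) hb.le
    exact (key hb hbc hx hxy).trans_le (mul_le_of_le_one_left hy.le hε1)
  refine ⟨ε / c, div_pos hε hc, fun x hx => ⟨?_, ?_, ?_⟩⟩
  · filter_upwards [hae, h.le_max] with ω hω hmax hxS
    by_contra! hcon
    obtain ⟨h1, h2⟩ := hcon
    rw [mem_twoExceed] at h1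
    push Not at h1
    obtain ⟨i, hi, hiS⟩ := hmax
    have hxi := hxS.trans_le hiS
    have hpos : 0 < X i ω := pos_of_mul_pos_right (hx.trans hxi) hc.le
    obtain ⟨h3, h4⟩ := hω (i, ℓ ω) rfl hpos fun k hk =>
      (h1 i k (Ne.symm hk) (key2 hc le_rfl hx hxi)).trans (key hc le_rfl hx hxi).le
    -- A vanishing coefficient would give `S = 0`, contradicting `0 < x < S`. This exactness is what
    -- removes all first-order terms when every coefficient is zero.
    have h5 : a (i, ℓ ω) ≠ 0 := fun h0 => by
      rw [h4 h0] at hxS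
      exact lt_asymm hx hxS
    have h6 := h2 (i, ℓ ω) h5 rfl
    have h7 := (abs_le.1 h3).2
    simp only at h6 h7
    nlinarith
  · filter_upwards [hae] with ω hω p hp hℓp hxp hbad
    rw [mem_twoExceed] at hbad
    push Not at hbad
    have hb : 0 < a p - δ := sub_pos.2 hp
    have hbc : a p - δ ≤ c := by linarith [h.coeff_le p]
    have hpos : 0 < X p.1 ω := pos_of_mul_pos_right (hx.trans hxp) hb.le
    obtain ⟨h3, -⟩ := hω p hℓp hpos fun k hk =>
      (hbad p.1 k (Ne.symm hk) (key2 hb hbc hx hxp)).trans (key hb hbc hx hxp).le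
    have h7 := (abs_le.1 h3).1
    nlinarith
  · intro ω p hp hxp
    exact key2 (sub_pos.2 hp) (by linarith [h.coeff_le p]) hx hxp

theorem isBigO_tail (hxmin : 0 < xmin) (hα : 0 < α) (hX : ∀ k, Measurable (X k))
    (hXlaw : ∀ k, μ.map (X k) = paretoMeasure xmin α) (hXindep : iIndepFun X μ)
    (h : DominatedByMax μ X ℓ S a c) (ha : ∀ p, a p = 0) :
    (fun x : ℝ => μ.real {ω | x < S ω}) =O[atTop] fun x : ℝ => x ^ (-(2 * α)) := by
  -- The value of `δ` is immaterial: with all coefficients zero, only joint exceedances remain.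
  obtain ⟨η, hη, hx⟩ := h.exists_sandwich one_pos
  refine IsBigO.of_bound ((Fintype.card N : ℝ) ^ 2 * (xmin ^ α * η ^ (-α)) ^ 2) ?_
  filter_upwards [eventually_gt_atTop 0] with x hx0
  have h1 : μ.real {ω | x < S ω} ≤ μ.real (twoExceed X (η * x)) := by
    refine measureReal_mono_ae ?_
    filter_upwards [(hx x hx0).1] with ω hω hS
    exact (hω hS).resolve_right fun ⟨p, hp, _⟩ => hp (ha p)
  have h2 := measureReal_twoExceed_le hxmin hα hX hXlaw hXindep (mul_pos hη hx0)
  rw [Real.norm_eq_abs, abs_of_nonneg measureReal_nonneg, Real.norm_eq_abs,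
    abs_of_nonneg (Real.rpow_nonneg hx0.le _)]
  refine (h1.trans h2).trans (le_of_eq ?_)
  have h3 : -(2 * α) = -α + -α := by ring
  rw [Real.mul_rpow hη.le hx0.le, h3, Real.rpow_add hx0]
  ring

theorem tendsto_tail (hxmin : 0 < xmin) (hα : 0 < α) (hX : ∀ k, Measurable (X k))
    (hXlaw : ∀ k, μ.map (X k) = paretoMeasure xmin α) (hXindep : iIndepFun X μ)
    (hℓ : Measurable ℓ) (hℓlaw : μ.map ℓ = uniformOn Set.univ)
    (hℓindep : IndepFun (fun ω k => X k ω) ℓ μ) (h : DominatedByMax μ X ℓ S a c) :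
    Tendsto (fun x : ℝ => μ.real {ω | x < S ω} * x ^ α) atTop
      (𝓝 (∑ p, xmin ^ α / Fintype.card E * a p ^ α)) := by
  -- Pairs with zero coefficient are dropped, so that `δ` can be taken below all remaining
  -- coefficients and `a p - δ` stays positive.
  set s : Finset (N × E) := Finset.univ.filter fun p => a p ≠ 0 with hs
  set f : ℝ → ℝ := fun δ => ∑ p ∈ s, xmin ^ α / Fintype.card E * (a p + δ) ^ α with hf
  have hmem : ∀ p, p ∈ s ↔ a p ≠ 0 := fun p => by simp [hs]
  have hf0 : f 0 = ∑ p, xmin ^ α / Fintype.card E * a p ^ α := by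
    simp only [hf, add_zero]
    refine Finset.sum_subset (Finset.subset_univ _) fun p _ hp => ?_
    rw [hmem, not_not] at hp
    rw [hp, Real.zero_rpow hα.ne', mul_zero]
  have hfc : ContinuousAt f 0 := by
    refine tendsto_finsetSum _ fun p hp => ?_
    refine tendsto_const_nhds.mul ?_
    have h1 : Tendsto (fun δ : ℝ => a p + δ) (𝓝 0) (𝓝 (a p + 0)) :=
      tendsto_const_nhds.add tendsto_id
    exact h1.rpow_const (Or.inr hα.le)
  rw [← hf0, Metric.tendsto_atTop']
  intro κ hκ
  have hδ : ∀ᶠ δ in 𝓝[>] (0 : ℝ), 0 < δ ∧ (∀ p ∈ s, δ < a p) ∧ |f δ - f 0| < κ / 2 ∧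
      |f (-δ) - f 0| < κ / 2 := by
    have h1 : ∀ᶠ δ in 𝓝 (0 : ℝ), |f δ - f 0| < κ / 2 :=
      hfc.eventually (Metric.ball_mem_nhds _ (half_pos hκ))
    have h2 : ∀ᶠ δ in 𝓝 (0 : ℝ), |f (-δ) - f 0| < κ / 2 := by
      have : Tendsto (fun δ : ℝ => -δ) (𝓝 0) (𝓝 0) := by
        simpa using (continuous_neg (G := ℝ)).tendsto 0
      exact this.eventually h1
    have h3 : ∀ᶠ δ in 𝓝 (0 : ℝ), ∀ p ∈ s, δ < a p := by
      rw [eventually_all_finset]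
      intro p hp
      exact eventually_lt_nhds (lt_of_le_of_ne (h.coeff_nonneg p) (Ne.symm ((hmem p).1 hp)))
    filter_upwards [self_mem_nhdsWithin, nhdsWithin_le_nhds h1, nhdsWithin_le_nhds h2,
      nhdsWithin_le_nhds h3] with δ d1 d2 d3 d4 using ⟨d1, d4, d2, d3⟩
  obtain ⟨δ, hδ0, hδa, hδ1, hδ2⟩ := hδ.exists
  obtain ⟨η, hη, hsand⟩ := h.exists_sandwich hδ0
  set B : ℝ → ℝ := fun x => μ.real (twoExceed X (η * x)) with hB
  -- The error event is charged at most once in the upper bound and once per pair in the lower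
  -- bound; `s.card + 1` covers both.
  have hBlim : Tendsto (fun x => (s.card + 1) * (B x * x ^ α)) atTop (𝓝 0) := by
    have h1 : Tendsto (fun x : ℝ => (Fintype.card N : ℝ) ^ 2 * (xmin ^ α * η ^ (-α)) ^ 2 *
        x ^ (-α)) atTop (𝓝 0) := by
      simpa using (tendsto_rpow_neg_atTop hα).const_mul
        ((Fintype.card N : ℝ) ^ 2 * (xmin ^ α * η ^ (-α)) ^ 2)
    have h2 : Tendsto (fun x => B x * x ^ α) atTop (𝓝 0) := by
      refine tendsto_of_tendsto_of_tendsto_of_le_of_le' tendsto_const_nhds h1 ?_ ?_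
      · filter_upwards [eventually_gt_atTop 0] with x hx0
        exact mul_nonneg measureReal_nonneg (Real.rpow_nonneg hx0.le _)
      · filter_upwards [eventually_gt_atTop 0] with x hx0
        refine (mul_le_mul_of_nonneg_right (measureReal_twoExceed_le hxmin hα hX hXlaw hXindep
          (mul_pos hη hx0)) (Real.rpow_nonneg hx0.le _)).trans (le_of_eq ?_)
        have h3 : x ^ (-α) * x ^ α = 1 := by
          rw [← Real.rpow_add hx0, neg_add_cancel, Real.rpow_zero]
        rw [Real.mul_rpow hη.le hx0.le]
        calc _ = (Fintype.card N : ℝ) ^ 2 * (xmin ^ α * η ^ (-α)) ^ 2 * x ^ (-α) *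
              (x ^ (-α) * x ^ α) := by ring
          _ = _ := by rw [h3, mul_one]
    simpa using h2.const_mul ((s.card : ℝ) + 1)
  have hlarge : ∀ᶠ x : ℝ in atTop, ∀ p ∈ s, xmin * (a p + δ) ≤ x ∧ xmin * (a p - δ) ≤ x := by
    rw [eventually_all_finset]
    intro p _
    exact (eventually_ge_atTop _).and (eventually_ge_atTop _)
  have hfinal : ∀ᶠ x : ℝ in atTop, |μ.real {ω | x < S ω} * x ^ α - f 0| < κ := by
    filter_upwards [hlarge, eventually_gt_atTop 0,
      hBlim.eventually (Metric.ball_mem_nhds _ (half_pos hκ))] with x hx hx0 hBx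
    obtain ⟨hup, hlow, hexc⟩ := hsand x hx0
    have hxα : 0 < x ^ α := Real.rpow_pos_of_pos hx0 _
    have hxx : x ^ (-α) * x ^ α = 1 := by
      rw [← Real.rpow_add hx0, neg_add_cancel, Real.rpow_zero]
    have hB0 : 0 ≤ B x * x ^ α := mul_nonneg measureReal_nonneg hxα.le
    have hBx' : (s.card + 1) * (B x * x ^ α) < κ / 2 := by
      have := (abs_lt.1 (by simpa [Real.dist_eq] using hBx :
        |(s.card + 1) * (B x * x ^ α)| < κ / 2)).2
      exact this
    have hcard : (0 : ℝ) ≤ s.card * (B x * x ^ α) := mul_nonneg (Nat.cast_nonneg _) hB0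
    have hupper : μ.real {ω | x < S ω} * x ^ α ≤ B x * x ^ α + f δ := by
      have h1 : μ.real {ω | x < S ω} ≤ B x +
          ∑ p ∈ s, μ.real {ω | ℓ ω = p.2 ∧ x < (a p + δ) * X p.1 ω} := by
        refine le_trans (measureReal_mono_ae (t := twoExceed X (η * x) ∪
          ⋃ p ∈ s, {ω | ℓ ω = p.2 ∧ x < (a p + δ) * X p.1 ω}) ?_)
          ((measureReal_union_le _ _).trans
            (add_le_add le_rfl (measureReal_biUnion_finset_le _ _)))
        filter_upwards [hup] with ω hω hS
        rcases hω hS with h2 | ⟨p, hp, h3⟩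
        · exact Or.inl h2
        · exact Or.inr (Set.mem_biUnion ((hmem p).2 hp) h3)
      have h2 : ∀ p ∈ s, μ.real {ω | ℓ ω = p.2 ∧ x < (a p + δ) * X p.1 ω} =
          xmin ^ α / Fintype.card E * (a p + δ) ^ α * x ^ (-α) := fun p hp =>
        measureReal_eq_and_lt hxmin hα hX hXlaw hℓ hℓlaw hℓindep p.1 p.2
          (by linarith [h.coeff_nonneg p]) (hx p hp).1
      rw [Finset.sum_congr rfl h2, ← Finset.sum_mul] at h1
      have h3 := mul_le_mul_of_nonneg_right h1 hxα.le
      rwa [add_mul, mul_assoc _ (x ^ (-α)), hxx, mul_one] at h3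
    have hlower : f (-δ) - s.card * (B x * x ^ α) ≤ μ.real {ω | x < S ω} * x ^ α := by
      set T : N × E → Set Ω := fun p => {ω | ℓ ω = p.2 ∧ x < (a p - δ) * X p.1 ω} with hT
      have hTm : ∀ p, MeasurableSet (T p) := fun p =>
        (hℓ (MeasurableSet.of_discrete (s := {p.2}))).inter
          (measurableSet_lt measurable_const ((hX p.1).const_mul _))
      have hbm := measurableSet_twoExceed hX (η * x)
      have h1 : ∑ p ∈ s, μ.real (T p \ twoExceed X (η * x)) ≤ μ.real {ω | x < S ω} := by
        rw [← measureReal_biUnion_finset ?_ fun p _ => (hTm p).diff hbm]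
        · refine measureReal_mono_ae ?_
          filter_upwards [hlow] with ω hω hm
          obtain ⟨p, hp, hpT, hpB⟩ := Set.mem_iUnion₂.1 hm
          exact hω p (hδa p hp) hpT.1 hpT.2 hpB
        -- Two distinct pairs on the same outcome share the line `ℓ ω`, so their nodes differ and
        -- two variables are large, which has been excluded.
        · intro p hp q hq hpq
          refine Set.disjoint_left.2 fun ω h1 h2 => h1.2 (mem_twoExceed.2 ⟨p.1, q.1, ?_,
            hexc ω p (hδa p hp) h1.1.2, hexc ω q (hδa q hq) h2.1.2⟩)
          intro h3
          exact hpq (Prod.ext h3 (h1.1.1.symm.trans h2.1.1))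
      have h2 : ∀ p ∈ s, xmin ^ α / Fintype.card E * (a p + -δ) ^ α * x ^ (-α) - B x ≤
          μ.real (T p \ twoExceed X (η * x)) := by
        intro p hp
        rw [← sub_eq_add_neg, ← measureReal_eq_and_lt hxmin hα hX hXlaw hℓ hℓlaw hℓindep p.1 p.2
          (sub_pos.2 (hδa p hp)) (hx p hp).2]
        exact le_measureReal_sdiff
      have h3 := (Finset.sum_le_sum h2).trans h1
      rw [Finset.sum_sub_distrib, ← Finset.sum_mul, Finset.sum_const, nsmul_eq_mul] at h3
      have h4 := mul_le_mul_of_nonneg_right h3 hxα.le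
      rw [sub_mul, mul_assoc _ (x ^ (-α)), hxx, mul_one, mul_assoc] at h4
      exact h4
    have h5 := abs_lt.1 hδ1
    have h6 := abs_lt.1 hδ2
    rw [add_mul, one_mul] at hBx'
    rw [abs_lt]
    constructor <;> linarith [h5.1, h5.2, h6.1, h6.2]
  obtain ⟨x₀, hx₀⟩ := eventually_atTop.1 hfinal
  exact ⟨x₀, fun x hx => hx₀ x (le_of_lt hx)⟩

end DominatedByMax

end Tail

/-! ### Assembly of the tail asymptotics. -/

theorem PowerGrid.numCutOff_le {N E : Type*} [Fintype N] [DecidableEq N] [Fintype E]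
    [DecidableEq E] (G : PowerGrid N E) (lam : ℝ) (i : N) (e₀ : E) :
    G.numCutOff lam i e₀ ≤ Fintype.card N := by
  rw [← Nat.card_eq_fintype_card]
  exact Set.ncard_le_card _

theorem mainTheorem1 {N E Ω : Type*} [Fintype N] [DecidableEq N] [Fintype E] [DecidableEq E]
    [MeasurableSpace E] [DiscreteMeasurableSpace E] [MeasurableSpace Ω]
    (G : PowerGrid N E) (lam : ℝ) (hlam : lam ∈ Set.Ioo (0 : ℝ) 1) (hG : G.NonDegenerate lam)
    (μ : Measure Ω) [IsProbabilityMeasure μ]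
    (xmin α : ℝ) (hxmin : 0 < xmin) (hα : 0 < α)
    -- the demands of the cities: i.i.d. Pareto with `P(X > x) = (x / xmin) ^ (-α)` on `x ≥ xmin`
    (X : N → Ω → ℝ) (hX : ∀ k, Measurable (X k))
    (hXlaw : ∀ k, μ.map (X k) = paretoMeasure xmin α) (hXindep : iIndepFun X μ)
    -- the first failure: uniform on the lines and independent of the demands
    (ℓ : Ω → E) (hℓ : Measurable ℓ) (hℓlaw : μ.map ℓ = uniformOn Set.univ)
    (hℓindep : IndepFun (fun ω k => X k ω) ℓ μ)
    -- the size of the blackout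
    (S : Ω → ℝ) (hS : Measurable S)
    (hSsize : ∀ᵐ ω ∂μ, G.IsBlackoutSize lam (fun k => X k ω) (ℓ ω) (S ω)) :
    ((∀ i e, G.numCutOff lam i e = 0) →
      (fun x : ℝ => μ.real {ω | x < S ω}) =O[atTop] fun x : ℝ => x ^ (-(2 * α))) ∧
    ((¬ ∀ i e, G.numCutOff lam i e = 0) →
      ∃ C : ℝ, 0 < C ∧
        C = ∑ i, ∑ e, xmin ^ α / Fintype.card E *
          (G.numCutOff lam i e * lam / Fintype.card N) ^ α ∧
        (fun x : ℝ => μ.real {ω | x < S ω}) ~[atTop] fun x : ℝ => C * x ^ (-α)) := by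
  have hpos : ∀ᵐ ω ∂μ, ∀ k, 0 < X k ω := ae_all_iff.2 fun k => by
    filter_upwards [ae_le_of_map_eq_paretoMeasure (hX k) (hXlaw k)] with ω hω
    exact hxmin.trans_le hω
  -- A single outcome with a blackout size already supplies a node and a line.
  obtain ⟨ω₀, s₀⟩ := hSsize.exists
  have : Nonempty N := by
    obtain ⟨_, _, i, _⟩ := s₀
    exact ⟨i⟩
  have : Nonempty E := ⟨ℓ ω₀⟩
  have hn : (1 : ℝ) ≤ Fintype.card N := by exact_mod_cast Fintype.card_pos
  have hn0 : (0 : ℝ) < Fintype.card N := by linarith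
  have hm : (0 : ℝ) < Fintype.card E := by exact_mod_cast Fintype.card_pos
  set a : N × E → ℝ := fun p => G.numCutOff lam p.1 p.2 * lam / Fintype.card N with ha
  have ha0 : ∀ p, a p = 0 ↔ G.numCutOff lam p.1 p.2 = 0 := fun p => by
    simp [ha, hlam.1.ne', hn0.ne']
  have ha_nonneg : ∀ p, 0 ≤ a p := fun p =>
    div_nonneg (mul_nonneg (Nat.cast_nonneg _) hlam.1.le) hn0.le
  have hdom : DominatedByMax μ X ℓ S a (Fintype.card N + (Fintype.card N : ℝ) ^ 2) := by
    refine ⟨?_, fun p δ hδ => ?_, ha_nonneg, fun p => ?_, by positivity⟩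
    · filter_upwards [hpos, hSsize] with ω h1 h2
      exact h2.exists_le hlam.1.le hlam.2.le fun k => (h1 k).le
    · obtain ⟨ε, hε, h⟩ := hG.exists_blackoutSize hlam p.1 p.2 hδ
      refine ⟨ε, hε, ?_⟩
      filter_upwards [hpos, hSsize] with ω h1 h2 hℓp hp hk
      obtain ⟨h3, h4⟩ := h (fun k => X k ω) (fun k => (h1 k).le) hp hk (S ω) (hℓp ▸ h2)
      exact ⟨h3, fun h0 => h4 ((ha0 p).1 h0)⟩
    · have hZ : (G.numCutOff lam p.1 p.2 : ℝ) ≤ Fintype.card N := by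
        exact_mod_cast G.numCutOff_le lam p.1 p.2
      have h1 : a p ≤ 1 := by
        rw [ha]
        simp only
        rw [div_le_one hn0]
        exact (mul_le_of_le_one_right (Nat.cast_nonneg _) hlam.2.le).trans hZ
      nlinarith
  refine ⟨fun h => hdom.isBigO_tail hxmin hα hX hXlaw hXindep fun p => (ha0 p).2 (h _ _),
    fun h => ?_⟩
  have hlim := hdom.tendsto_tail hxmin hα hX hXlaw hXindep hℓ hℓlaw hℓindep
  set C := ∑ p, xmin ^ α / Fintype.card E * a p ^ α with hC
  have hC0 : 0 < C := by
    push Not at h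
    obtain ⟨i, e, hie⟩ := h
    refine Finset.sum_pos' (fun p _ => mul_nonneg (div_nonneg (Real.rpow_nonneg hxmin.le _) hm.le)
      (Real.rpow_nonneg (ha_nonneg p) _)) ⟨(i, e), Finset.mem_univ _, ?_⟩
    exact mul_pos (div_pos (Real.rpow_pos_of_pos hxmin _) hm) (Real.rpow_pos_of_pos
      (lt_of_le_of_ne (ha_nonneg _) (Ne.symm (mt (ha0 (i, e)).1 hie))) _)
  refine ⟨C, hC0, by rw [hC, Fintype.sum_prod_type], ?_⟩
  refine (isEquivalent_iff_tendsto_one ?_).2 ?_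
  · filter_upwards [eventually_gt_atTop 0] with x hx
    exact (mul_pos hC0 (Real.rpow_pos_of_pos hx _)).ne'
  · have h1 := hlim.div_const C
    rw [div_self hC0.ne'] at h1
    refine h1.congr' ?_
    filter_upwards [eventually_gt_atTop 0] with x hx
    have := Real.rpow_pos_of_pos hx α
    simp only [Pi.div_apply]
    rw [Real.rpow_neg hx.le]
    field_simp
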